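/- Let $H$ be a separable infinite-dimensional complex Hilbert space, let $\mathbf D$ be the open unit disk, and let $H^\infty$ be the algebra of bounded analytic functions on $\mathbf D$. Let $T$ be a bounded linear operator on $H$ that is a completely non-unitary contraction, i.e. $\|T\|\le 1$ and the restriction of $T$ to any nonzero reducing subspace is not unitary. For $u\in H^\infty$ with $u(z)=\sum_{n\ge 0}a_nz^n$, let $u(T)$ denote the Sz.-Nagy--Foias functional calculus, $u(T)x=\lim_{r\to 1^-}\sum_{n\ge 0}a_nr^nT^nx$ for $x\in H$. Suppose that $T$ is transcendental, i.e. for every nonzero $x\in H$ and every nonzero $u\in H^\infty$ one has $u(T)x\ne 0$. Then for every nonzero $h\in H$ and every non-constant $\theta\in H^\infty$ the vectors $\theta(T)^nh$, $n=1,2,\dots$, are pairwise distinct and the set $\{\theta(T)^nh : n=1,2,\dots\}$ is linearly independent. -/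

import Mathlib

open Filter Topology

/-- `u` restricts to an element of `H^∞`: it is analytic and bounded on the open unit disk.
(The values of `u` outside the disk are irrelevant to everything below.) -/
def MemHInfty (u : ℂ → ℂ) : Prop :=
  DifferentiableOn ℂ u (Metric.ball (0 : ℂ) 1) ∧
    ∃ C : ℝ, ∀ z ∈ Metric.ball (0 : ℂ) 1, ‖u z‖ ≤ C

/-- `u` is not the zero element of `H^∞`. -/
def NonzeroOnDisk (u : ℂ → ℂ) : Prop :=
  ∃ z ∈ Metric.ball (0 : ℂ) 1, u z ≠ 0

/-- `u` is not constant on the open unit disk. -/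
def NonconstantOnDisk (u : ℂ → ℂ) : Prop :=
  ¬ ∃ c : ℂ, ∀ z ∈ Metric.ball (0 : ℂ) 1, u z = c

/-- The `n`-th Taylor coefficient of `u` at the origin. -/
noncomputable def taylorCoeffZero (u : ℂ → ℂ) (n : ℕ) : ℂ :=
  iteratedDeriv n u 0 / (n.factorial : ℂ)

section Operators

variable {H : Type*} [NormedAddCommGroup H] [InnerProductSpace ℂ H]

/-- `T` is a completely non-unitary contraction: `‖T‖ ≤ 1`, and the restriction of `T` to a
nonzero (closed) reducing subspace `M` is never unitary, that is, never an isometry of `M`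
onto `M`. Reducing means that `M` and its orthogonal complement are both invariant. -/
def IsCNUContraction (T : H →L[ℂ] H) : Prop :=
  ‖T‖ ≤ 1 ∧
    ∀ M : Submodule ℂ H, IsClosed (M : Set H) → M ≠ ⊥ →
      (∀ x ∈ M, T x ∈ M) → (∀ x ∈ Mᗮ, T x ∈ Mᗮ) →
      ¬ ((∀ x ∈ M, ‖T x‖ = ‖x‖) ∧ (∀ y ∈ M, ∃ x ∈ M, T x = y))

/-- The operator `u_r(T) = ∑ aₙ rⁿ Tⁿ`, where `u(z) = ∑ aₙ zⁿ` on the disk. For a contraction `T`,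
`u ∈ H^∞` and `0 ≤ r < 1` the series converges absolutely in operator norm. -/
noncomputable def dilatedCalculus (T : H →L[ℂ] H) (u : ℂ → ℂ) (r : ℝ) : H →L[ℂ] H :=
  ∑' n : ℕ, (taylorCoeffZero u n * (r : ℂ) ^ n) • T ^ n

/-- `S` is the limit of `u_r(T)` in the strong operator topology as `r` increases to `1`. -/
def IsHInftyCalculusValue (T : H →L[ℂ] H) (u : ℂ → ℂ) (S : H →L[ℂ] H) : Prop :=
  ∀ x : H, Tendsto (fun r : ℝ => dilatedCalculus T u r x) (𝓝[<] (1 : ℝ)) (𝓝 (S x))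

open Classical in
/-- The Sz.-Nagy–Foias functional calculus `u(T)`, defined as by Sz.-Nagy and Foias: the strong
operator limit of `u_r(T)` as `r` increases to `1`. For a completely non-unitary contraction `T`
on a Hilbert space and `u ∈ H^∞` this limit always exists, and `u ↦ u(T)` is the unique
contractive weak-* continuous algebra representation of `H^∞` with `1 ↦ I` and `z ↦ T`.
(Outside this setting, where the limit may fail to exist, the value is `0` by convention.) -/
noncomputable def hInftyCalculus (T : H →L[ℂ] H) (u : ℂ → ℂ) : H →L[ℂ] H :=
  if h : ∃ S : H →L[ℂ] H, IsHInftyCalculusValue T u S then h.choose else 0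

/-- The value of the functional calculus is the strong limit whenever that limit exists. -/
theorem hInftyCalculus_eq {T : H →L[ℂ] H} {u : ℂ → ℂ} {S : H →L[ℂ] H}
    (hS : IsHInftyCalculusValue T u S) : hInftyCalculus T u = S := by
  have h : ∃ S : H →L[ℂ] H, IsHInftyCalculusValue T u S := ⟨S, hS⟩
  rw [hInftyCalculus, dif_pos h]
  ext x
  exact tendsto_nhds_unique (h.choose_spec x) (hS x)

/-- `h` is algebraic with respect to `T`: `θ(T) h = 0` for some nonzero `θ ∈ H^∞`. -/
def IsAlgebraicElement (T : H →L[ℂ] H) (h : H) : Prop :=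
  ∃ θ : ℂ → ℂ, MemHInfty θ ∧ NonzeroOnDisk θ ∧ hInftyCalculus T θ h = 0

/-- `T` is a transcendental operator: a completely non-unitary contraction without a nonzero
algebraic element. -/
def IsTranscendentalOperator (T : H →L[ℂ] H) : Prop :=
  IsCNUContraction T ∧ ∀ h : H, h ≠ 0 → ¬ IsAlgebraicElement T h

end Operators

/-! Let `p` be a nonzero polynomial. Then `p(θ(T)) = (p ∘ θ)(T)`, and `p ∘ θ` is a nonzero element
of `H^∞`: otherwise `θ` would map the connected disk into the finite root set of `p` and be
constant. Transcendence gives `p(θ(T)) h ≠ 0` for every such `p`, which is linear independence of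
the vectors `θ(T)ⁿ h`, `n ≥ 0`.

The weight lies in the identity `p(θ(T)) = (p ∘ θ)(T)`. It requires the strong limit of `u_r(T)` to
exist; otherwise `hInftyCalculus` is `0` by default. Scalar measures on the circle replace the
unitary dilation here. Contractivity makes the moments `⟪x, Tⁿ x⟫` positive definite, so they are
the Fourier coefficients of a positive measure `μ`, and moreover `‖p(T) x‖² ≤ ∫ |p|² dμ` for
polynomials `p` (`IsElementaryMeasure.norm_aeval_sq_le`).

If `T` is completely non-unitary, then `μ` is absolutely continuous
(`IsElementaryMeasure.absolutelyContinuous`). Indeed there are polynomials `z qₖ(z)`, bounded by one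
on the circle, that tend to `1` in mean for the singular part of `μ` and to `0` for the rest. The
vectors `T qₖ(T) x` converge to a vector of a reducing subspace on which `T` is unitary, hence to
`0`; but `⟪x, T qₖ(T) x⟫` tends to the mass of the singular part.

Finally the dilates `u_r` are uniformly bounded and Cauchy in mean square for Haar measure, by
Parseval. Absolute continuity passes this on to `μ`, so `u_r(T) x` is Cauchy as `r → 1`. -/

open MeasureTheory AddCircle ComplexConjugate

/-! ### Positive definiteness of the moments of a contraction -/

section Moments

variable {H : Type*} [NormedAddCommGroup H] [InnerProductSpace ℂ H]

/-- The moments of the elementary measure of a contraction `T` at a vector `x`: `⟪x, Tⁿ x⟫` for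
`n ≥ 0`, extended to negative indices by conjugation. -/
noncomputable def powerMoment (T : H →L[ℂ] H) (x : H) : ℤ → ℂ
  | Int.ofNat n => inner ℂ x ((T ^ n) x)
  | Int.negSucc n => inner ℂ ((T ^ (n + 1)) x) x

theorem powerMoment_natCast (T : H →L[ℂ] H) (x : H) (n : ℕ) :
    powerMoment T x (n : ℤ) = inner ℂ x ((T ^ n) x) := rfl

theorem powerMoment_neg_natCast (T : H →L[ℂ] H) (x : H) (n : ℕ) :
    powerMoment T x (-(n : ℤ)) = inner ℂ ((T ^ n) x) x := by
  cases n with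
  | zero => simp [powerMoment]
  | succ n => rfl

theorem powerMoment_neg (T : H →L[ℂ] H) (x : H) (n : ℤ) :
    powerMoment T x (-n) = conj (powerMoment T x n) := by
  obtain ⟨k, rfl | rfl⟩ := n.eq_nat_or_neg
  · rw [powerMoment_neg_natCast, powerMoment_natCast, inner_conj_symm]
  · rw [neg_neg, powerMoment_neg_natCast, powerMoment_natCast, inner_conj_symm]

/-- The Toeplitz form attached to the moments of `T` at `x`. -/
noncomputable def toeplitzForm (T : H →L[ℂ] H) (x : H) (N : ℕ) (a : ℕ → ℂ) : ℂ :=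
  ∑ i ∈ Finset.range N, ∑ j ∈ Finset.range N, conj (a i) * a j * powerMoment T x (j - i)

theorem conj_toeplitzForm (T : H →L[ℂ] H) (x : H) (N : ℕ) (a : ℕ → ℂ) :
    conj (toeplitzForm T x N a) = toeplitzForm T x N a := by
  unfold toeplitzForm
  simp only [map_sum, map_mul, Complex.conj_conj]
  rw [Finset.sum_comm]
  refine Finset.sum_congr rfl fun i _ => Finset.sum_congr rfl fun j _ => ?_
  rw [← powerMoment_neg, neg_sub]
  ring

theorem ofReal_re_toeplitzForm (T : H →L[ℂ] H) (x : H) (N : ℕ) (a : ℕ → ℂ) :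
    (((toeplitzForm T x N a).re : ℝ) : ℂ) = toeplitzForm T x N a :=
  Complex.conj_eq_iff_re.1 (conj_toeplitzForm T x N a)

/-- Row and column `0` are split off. With `y` the sum for the shifted coefficients, the full sum is
`T y + a₀ x`; the split-off terms are `‖a₀ x‖² + 2 Re ⟪T y, a₀ x⟫`, and completing the square gives
the difference of norms. -/
theorem toeplitzForm_succ_re (T : H →L[ℂ] H) (x : H) (N : ℕ) (a : ℕ → ℂ) :
    (toeplitzForm T x (N + 1) a).re = ‖∑ i ∈ Finset.range (N + 1), a i • (T ^ i) x‖ ^ 2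
      - ‖T (∑ i ∈ Finset.range N, a (i + 1) • (T ^ i) x)‖ ^ 2
      + (toeplitzForm T x N fun i => a (i + 1)).re := by
  set y := ∑ i ∈ Finset.range N, a (i + 1) • (T ^ i) x with hy
  have hTy : T y = ∑ i ∈ Finset.range N, a (i + 1) • (T ^ (i + 1)) x := by
    simp [hy, map_sum, pow_succ']
  have h1 : ∑ i ∈ Finset.range (N + 1), a i • (T ^ i) x = T y + a 0 • x := by
    rw [Finset.sum_range_succ', hTy]; simp
  have hrow : ∑ j ∈ Finset.range N, conj (a 0) * a (j + 1) * powerMoment T x ((j : ℤ) + 1)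
      = inner ℂ (a 0 • x) (T y) := by
    rw [hTy, inner_sum]
    refine Finset.sum_congr rfl fun j _ => ?_
    rw [inner_smul_left, inner_smul_right, ← powerMoment_natCast]
    push_cast
    ring
  have hcol : ∑ j ∈ Finset.range N, conj (a (j + 1)) * a 0 * powerMoment T x (-((j : ℤ) + 1))
      = inner ℂ (T y) (a 0 • x) := by
    rw [← inner_conj_symm, ← hrow, map_sum]
    refine Finset.sum_congr rfl fun j _ => ?_
    rw [powerMoment_neg]
    simp only [map_mul, Complex.conj_conj]
    ring
  have h00 : conj (a 0) * a 0 * powerMoment T x 0 = ((‖a 0 • x‖ ^ 2 : ℝ) : ℂ) := by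
    have : powerMoment T x 0 = inner ℂ x x := by simpa using powerMoment_natCast T x 0
    rw [this, inner_self_eq_norm_sq_to_K, norm_smul, mul_pow, ← Complex.normSq_eq_conj_mul_self,
      Complex.normSq_eq_norm_sq]
    simp
  have hsplit : toeplitzForm T x (N + 1) a = (toeplitzForm T x N fun i => a (i + 1))
      + inner ℂ (T y) (a 0 • x) + inner ℂ (a 0 • x) (T y) + ((‖a 0 • x‖ ^ 2 : ℝ) : ℂ) := by
    rw [← h00, ← hrow, ← hcol, toeplitzForm, Finset.sum_range_succ']
    simp only [Finset.sum_range_succ', Finset.sum_add_distrib]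
    push_cast
    simp only [add_sub_add_right_eq_sub, sub_zero, zero_sub]
    rw [toeplitzForm]
    ring
  rw [hsplit, h1, @norm_add_sq ℂ]
  have : (inner ℂ (a 0 • x) (T y)).re = (inner ℂ (T y) (a 0 • x)).re := by
    rw [← inner_conj_symm, Complex.conj_re]
  simp only [Complex.add_re, Complex.ofReal_re, this]
  simp only [RCLike.re_eq_complex_re]
  ring

/-- In the induction, contractivity lets the hypothesis for `‖y‖²` absorb the term `-‖T y‖²`. The
bound is stronger than nonnegativity of the form, and this surplus later controls `‖p(T) x‖` by an
integral. -/
theorem norm_sum_smul_pow_sq_le_toeplitzForm {T : H →L[ℂ] H} (hT : ‖T‖ ≤ 1) (x : H) (N : ℕ)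
    (a : ℕ → ℂ) :
    ‖∑ i ∈ Finset.range N, a i • (T ^ i) x‖ ^ 2 ≤ (toeplitzForm T x N a).re := by
  induction N generalizing a with
  | zero => simp [toeplitzForm]
  | succ N ih =>
    rw [toeplitzForm_succ_re]
    have h1 := ih fun i => a (i + 1)
    have h2 : ‖T (∑ i ∈ Finset.range N, a (i + 1) • (T ^ i) x)‖
        ≤ ‖∑ i ∈ Finset.range N, a (i + 1) • (T ^ i) x‖ :=
      (T.le_of_opNorm_le hT _).trans_eq (one_mul _)
    have h3 := pow_le_pow_left₀ (norm_nonneg _) h2 2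
    linarith

end Moments

/-! ### The elementary measure as a weak limit of Fejér means -/

section ElementaryMeasure

theorem integral_fourier (n : ℤ) :
    ∫ t : AddCircle (1 : ℝ), (fourier n t : ℂ) ∂haarAddCircle = if n = 0 then 1 else 0 := by
  have h := congrFun (fourierCoeff_fourier (T := 1) n) 0
  simp only [fourierCoeff, neg_zero, fourier_zero, one_smul] at h
  rw [h, Pi.single_apply]
  simp only [eq_comm]

variable {H : Type*} [NormedAddCommGroup H] [InnerProductSpace ℂ H]

/-- The Fejér means of the moments of `T` at `x`. -/
noncomputable def fejerDensity (T : H →L[ℂ] H) (x : H) (N : ℕ) (t : AddCircle (1 : ℝ)) : ℝ :=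
  (N : ℝ)⁻¹ * (toeplitzForm T x N fun j => fourier (-(j : ℤ)) t).re

theorem fejerDensity_nonneg {T : H →L[ℂ] H} (hT : ‖T‖ ≤ 1) (x : H) (N : ℕ)
    (t : AddCircle (1 : ℝ)) : 0 ≤ fejerDensity T x N t :=
  mul_nonneg (by positivity)
    ((sq_nonneg _).trans (norm_sum_smul_pow_sq_le_toeplitzForm hT x N _))

theorem ofReal_fejerDensity (T : H →L[ℂ] H) (x : H) (N : ℕ) (t : AddCircle (1 : ℝ)) :
    (fejerDensity T x N t : ℂ) = (N : ℂ)⁻¹ * ∑ i ∈ Finset.range N, ∑ j ∈ Finset.range N,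
      powerMoment T x (j - i) * fourier ((i : ℤ) - j) t := by
  rw [fejerDensity, Complex.ofReal_mul, ofReal_re_toeplitzForm, toeplitzForm]
  push_cast
  congr 1
  refine Finset.sum_congr rfl fun i _ => Finset.sum_congr rfl fun j _ => ?_
  rw [← fourier_neg, neg_neg, ← fourier_add, mul_comm, sub_eq_add_neg (i : ℤ)]

theorem continuous_fejerDensity (T : H →L[ℂ] H) (x : H) (N : ℕ) :
    Continuous (fejerDensity T x N) := by
  have h : Continuous fun t => (fejerDensity T x N t : ℂ) := by
    simp only [ofReal_fejerDensity]
    fun_prop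
  exact Complex.continuous_re.comp h

/-- Orthogonality keeps only the diagonal `j = n + i` of the `N × N` array, which has `N - n`
entries. -/
theorem integral_fourier_mul_fejerDensity (T : H →L[ℂ] H) (x : H) {N n : ℕ} (hn : n ≤ N) :
    ∫ t, fourier (n : ℤ) t * (fejerDensity T x N t : ℂ) ∂haarAddCircle
      = (N : ℂ)⁻¹ * (N - n) * inner ℂ x ((T ^ n) x) := by
  have h1 : ∀ t : AddCircle (1 : ℝ), fourier (n : ℤ) t * (fejerDensity T x N t : ℂ)
      = (N : ℂ)⁻¹ * ∑ i ∈ Finset.range N, ∑ j ∈ Finset.range N,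
        powerMoment T x (j - i) * fourier ((n : ℤ) + (i - j)) t := by
    intro t
    rw [ofReal_fejerDensity, mul_left_comm, Finset.mul_sum]
    congr 1
    refine Finset.sum_congr rfl fun i _ => ?_
    rw [Finset.mul_sum]
    refine Finset.sum_congr rfl fun j _ => ?_
    rw [fourier_add]
    ring
  have hint : ∀ (c : ℂ) (k : ℤ),
      Integrable (fun t : AddCircle (1 : ℝ) => c * fourier k t) haarAddCircle :=
    fun c k => (Continuous.integrable_of_hasCompactSupport (by fun_prop)
      (HasCompactSupport.of_compactSpace _))
  simp only [h1]
  rw [integral_const_mul, integral_finsetSum _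
    fun i _ => integrable_finsetSum _ fun j _ => hint _ _]
  rw [mul_assoc]
  congr 1
  have h2 : ∀ i ∈ Finset.range N, ∫ t, ∑ j ∈ Finset.range N,
        powerMoment T x (j - i) * fourier ((n : ℤ) + (i - j)) t ∂(haarAddCircle (T := 1))
      = if i ∈ Finset.range (N - n) then inner ℂ x ((T ^ n) x) else 0 := by
    intro i _
    rw [integral_finsetSum _ fun j _ => hint _ _]
    simp only [integral_const_mul, integral_fourier]
    have : ∀ j : ℕ, powerMoment T x (j - i) * (if (n : ℤ) + (i - j) = 0 then 1 else 0)
        = if j = n + i then inner ℂ x ((T ^ n) x) else 0 := by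
      intro j
      by_cases hj : j = n + i
      · subst hj
        simp [powerMoment_natCast]
      · have : ¬ ((n : ℤ) + (i - j) = 0) := by omega
        simp [hj, this]
    simp only [this, Finset.sum_ite_eq', Finset.mem_range]
    congr 1
    apply propext
    omega
  rw [Finset.sum_congr rfl h2, Finset.sum_ite_mem,
    Finset.inter_eq_right.2 (Finset.range_mono (Nat.sub_le N n))]
  simp [Nat.cast_sub hn]

/-- Every contraction `T` and vector `x` have an elementary measure on the circle: a finite positive
measure with Fourier coefficients `⟪x, Tⁿ x⟫`. -/
theorem exists_measure_integral_fourier_eq_inner {T : H →L[ℂ] H} (hT : ‖T‖ ≤ 1) (x : H) :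
    ∃ μ : Measure (AddCircle (1 : ℝ)), IsFiniteMeasure μ ∧
      ∀ n : ℕ, ∫ t, (fourier (n : ℤ) t : ℂ) ∂μ = inner ℂ x ((T ^ n) x) := by
  have hint : ∀ N, Integrable (fejerDensity T x N) haarAddCircle := fun N =>
    (continuous_fejerDensity T x N).integrable_of_hasCompactSupport
      (HasCompactSupport.of_compactSpace _)
  have hreal : ∀ N : ℕ, 1 ≤ N → ∫ t, fejerDensity T x N t ∂haarAddCircle = ‖x‖ ^ 2 := by
    intro N hN
    have h := integral_fourier_mul_fejerDensity T x (Nat.zero_le N)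
    have hN' : (N : ℂ) ≠ 0 := by exact_mod_cast (by omega : N ≠ 0)
    simp only [Nat.cast_zero, fourier_zero, one_mul, sub_zero, inv_mul_cancel₀ hN', pow_zero,
      one_apply_eq_self] at h
    rw [integral_complex_ofReal, inner_self_eq_norm_sq_to_K] at h
    have h' : ((∫ t, fejerDensity T x N t ∂haarAddCircle : ℝ) : ℂ) = ((‖x‖ ^ 2 : ℝ) : ℂ) := by
      rw [h]; simp
    exact Complex.ofReal_injective h'
  -- The shift to `N + 1` avoids the empty mean, so that every measure has mass exactly `‖x‖²`.
  let m : ℕ → Measure (AddCircle (1 : ℝ)) := fun N =>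
    haarAddCircle.withDensity fun t => ENNReal.ofReal (fejerDensity T x (N + 1) t)
  have hm : ∀ N, m N Set.univ = ENNReal.ofReal (‖x‖ ^ 2) := by
    intro N
    rw [withDensity_apply _ MeasurableSet.univ, Measure.restrict_univ,
      ← ofReal_integral_eq_lintegral_ofReal (hint _)
        (Eventually.of_forall (fejerDensity_nonneg hT x _)), hreal _ (by omega)]
  have hfin : ∀ N, IsFiniteMeasure (m N) := fun N => ⟨by rw [hm]; exact ENNReal.ofReal_lt_top⟩
  let ν : ℕ → FiniteMeasure (AddCircle (1 : ℝ)) := fun N => ⟨m N, hfin N⟩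
  have hνmem : ∀ N, ν N ∈ {μ : FiniteMeasure (AddCircle (1 : ℝ)) | μ.mass ≤ (‖x‖ ^ 2).toNNReal} := by
    intro N
    rw [Set.mem_ofPred_eq, ← ENNReal.coe_le_coe, FiniteMeasure.ennreal_mass]
    exact (hm N).le
  -- Weak compactness is used along an ultrafilter, so no subsequence has to be extracted.
  obtain ⟨μ, -, hμ⟩ := (isCompact_setOfPred_finiteMeasure_le_of_compactSpace
    (AddCircle (1 : ℝ)) (‖x‖ ^ 2).toNNReal).ultrafilter_le_nhds
      ((Filter.hyperfilter ℕ).map ν) (by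
        rw [le_principal_iff]
        exact Filter.mem_map.2 (Filter.univ_mem' hνmem))
  refine ⟨μ, inferInstance, fun n => ?_⟩
  have hlim := (FiniteMeasure.tendsto_iff_forall_integral_rclike_tendsto ℂ).1
    (show Tendsto ν (Filter.hyperfilter ℕ : Filter ℕ) (𝓝 μ) from hμ)
    (BoundedContinuousFunction.mkOfCompact (fourier (n : ℤ)))
  refine tendsto_nhds_unique hlim ?_
  have hval : ∀ᶠ N in atTop, ∫ t, (fourier (n : ℤ) t : ℂ) ∂(m N)
      = (1 - (n : ℂ) * ((N + 1 : ℕ) : ℂ)⁻¹) * inner ℂ x ((T ^ n) x) := by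
    filter_upwards [eventually_ge_atTop n] with N hN
    rw [integral_withDensity_eq_integral_toReal_smul
      (continuous_fejerDensity T x _).measurable.ennreal_ofReal
      (Eventually.of_forall fun _ => ENNReal.ofReal_lt_top)]
    have hN' : ((N + 1 : ℕ) : ℂ) ≠ 0 := by exact_mod_cast Nat.succ_ne_zero N
    have := integral_fourier_mul_fejerDensity T x (show n ≤ N + 1 by omega)
    rw [mul_sub, inv_mul_cancel₀ hN', mul_comm _ (n : ℂ)] at this
    rw [← this]
    refine integral_congr_ae (Eventually.of_forall fun t => ?_)
    simp only [ENNReal.toReal_ofReal (fejerDensity_nonneg hT x _ t), Complex.real_smul]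
    rw [mul_comm]
  have hlim2 : Tendsto (fun N : ℕ => (1 - (n : ℂ) * ((N + 1 : ℕ) : ℂ)⁻¹) * inner ℂ x ((T ^ n) x))
      atTop (𝓝 (inner ℂ x ((T ^ n) x))) := by
    have h0 : Tendsto (fun N : ℕ => ((N + 1 : ℕ) : ℂ)⁻¹) atTop (𝓝 0) :=
      (tendsto_inv_atTop_nhds_zero_nat (𝕜 := ℂ)).comp (tendsto_add_atTop_nat 1)
    simpa using ((h0.const_mul (n : ℂ)).const_sub 1).mul_const (inner ℂ x ((T ^ n) x))
  exact ((hlim2.congr' (hval.mono fun _ h => h.symm))).mono_left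
    Nat.hyperfilter_le_atTop

end ElementaryMeasure

/-! ### Square integrals of power series on the circle -/

section SquareIntegrals

theorem fourier_natCast_eq_pow (n : ℕ) (t : AddCircle (1 : ℝ)) :
    (fourier (n : ℤ) t : ℂ) = fourier 1 t ^ n := by
  induction n with
  | zero => simp
  | succ n ih => rw [pow_succ, ← ih, ← fourier_add]; push_cast; rfl

theorem norm_fourier_apply (n : ℤ) (t : AddCircle (1 : ℝ)) : ‖(fourier n t : ℂ)‖ = 1 := by
  rw [fourier_apply]; exact Circle.norm_coe _

theorem Continuous.integrable_addCircle {E : Type*} [NormedAddCommGroup E]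
    {μ : Measure (AddCircle (1 : ℝ))} [IsFiniteMeasure μ] {f : AddCircle (1 : ℝ) → E}
    (hf : Continuous f) : Integrable f μ :=
  hf.integrable_of_hasCompactSupport (HasCompactSupport.of_compactSpace _)

theorem integral_norm_sq_sum_fourier (μ : Measure (AddCircle (1 : ℝ))) [IsFiniteMeasure μ]
    (N : ℕ) (a : ℕ → ℂ) :
    ((∫ t, ‖∑ i ∈ Finset.range N, a i * fourier (i : ℤ) t‖ ^ 2 ∂μ : ℝ) : ℂ)
      = ∑ i ∈ Finset.range N, ∑ j ∈ Finset.range N,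
        conj (a i) * a j * ∫ t, (fourier ((j : ℤ) - i) t : ℂ) ∂μ := by
  rw [← integral_complex_ofReal]
  have h : ∀ t : AddCircle (1 : ℝ),
      ((‖∑ i ∈ Finset.range N, a i * fourier (i : ℤ) t‖ ^ 2 : ℝ) : ℂ)
      = ∑ i ∈ Finset.range N, ∑ j ∈ Finset.range N,
        conj (a i) * a j * (fourier ((j : ℤ) - i) t : ℂ) := by
    intro t
    rw [← Complex.normSq_eq_norm_sq, Complex.normSq_eq_conj_mul_self, map_sum,
      Finset.sum_mul_sum]
    refine Finset.sum_congr rfl fun i _ => Finset.sum_congr rfl fun j _ => ?_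
    rw [map_mul, ← fourier_neg, sub_eq_add_neg, fourier_add]
    ring
  simp only [h]
  rw [integral_finsetSum _ fun i _ => Continuous.integrable_addCircle (by fun_prop)]
  refine Finset.sum_congr rfl fun i _ => ?_
  rw [integral_finsetSum _ fun j _ => Continuous.integrable_addCircle (by fun_prop)]
  refine Finset.sum_congr rfl fun j _ => ?_
  rw [integral_const_mul]

theorem continuous_tsum_fourier {a : ℕ → ℂ} (ha : Summable fun n => ‖a n‖) :
    Continuous fun t : AddCircle (1 : ℝ) => ∑' n : ℕ, a n * fourier (n : ℤ) t :=
  continuous_tsum (fun n => by fun_prop) ha fun n t => by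
    rw [norm_mul, norm_fourier_apply, mul_one]

theorem tendsto_integral_norm_sq_sum_fourier (μ : Measure (AddCircle (1 : ℝ)))
    [IsFiniteMeasure μ] {a : ℕ → ℂ} (ha : Summable fun n => ‖a n‖) :
    Tendsto (fun N : ℕ => ∫ t, ‖∑ i ∈ Finset.range N, a i * fourier (i : ℤ) t‖ ^ 2 ∂μ) atTop
      (𝓝 (∫ t, ‖∑' n : ℕ, a n * fourier (n : ℤ) t‖ ^ 2 ∂μ)) := by
  have hn : ∀ (t : AddCircle (1 : ℝ)) (i : ℕ), ‖a i * fourier (i : ℤ) t‖ = ‖a i‖ := fun t i => by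
    rw [norm_mul, norm_fourier_apply, mul_one]
  refine tendsto_integral_of_dominated_convergence (fun _ => (∑' n, ‖a n‖) ^ 2)
    (fun N => Continuous.aestronglyMeasurable (by fun_prop)) (integrable_const _)
    (fun N => Eventually.of_forall fun t => ?_) (Eventually.of_forall fun t => ?_)
  · rw [Real.norm_of_nonneg (by positivity)]
    gcongr
    refine (norm_sum_le _ _).trans ?_
    simp only [hn]
    exact ha.sum_le_tsum _ fun _ _ => norm_nonneg _
  · have hs : Summable fun n : ℕ => a n * fourier (n : ℤ) t :=
      Summable.of_norm (by simpa only [hn] using ha)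
    exact (hs.hasSum.tendsto_sum_nat.norm).pow 2

/-- Parseval's identity for an absolutely convergent power series on the circle. -/
theorem hasSum_norm_sq_integral_norm_sq_tsum_fourier {a : ℕ → ℂ} (ha : Summable fun n => ‖a n‖) :
    HasSum (fun n => ‖a n‖ ^ 2)
      (∫ t, ‖∑' n : ℕ, a n * fourier (n : ℤ) t‖ ^ 2 ∂(haarAddCircle (T := 1))) := by
  rw [hasSum_iff_tendsto_nat_of_nonneg fun _ => by positivity]
  refine (tendsto_integral_norm_sq_sum_fourier haarAddCircle ha).congr fun N => ?_
  apply Complex.ofReal_injective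
  rw [integral_norm_sq_sum_fourier]
  push_cast
  refine Finset.sum_congr rfl fun i hi => ?_
  have h : ∀ j : ℕ, conj (a i) * a j * ∫ t, (fourier ((j : ℤ) - i) t : ℂ) ∂(haarAddCircle (T := 1))
      = if j = i then (‖a i‖ : ℂ) ^ 2 else 0 := by
    intro j
    rw [integral_fourier]
    by_cases hj : j = i
    · subst hj
      rw [if_pos (by omega), if_pos rfl, mul_one, ← Complex.normSq_eq_conj_mul_self,
        Complex.normSq_eq_norm_sq]
      push_cast; rfl
    · rw [if_neg (by omega), if_neg hj, mul_zero]
  simp only [h, Finset.sum_ite_eq', if_pos hi]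

end SquareIntegrals

/-! ### Von Neumann's inequality through elementary measures -/

section VonNeumann

variable {H : Type*} [NormedAddCommGroup H] [InnerProductSpace ℂ H]

/-- `μ` is the elementary measure of `T` at `x`: its `n`-th Fourier coefficient is `⟪x, Tⁿ x⟫`. -/
def IsElementaryMeasure (T : H →L[ℂ] H) (x : H) (μ : Measure (AddCircle (1 : ℝ))) : Prop :=
  ∀ n : ℕ, ∫ t, (fourier (n : ℤ) t : ℂ) ∂μ = inner ℂ x ((T ^ n) x)

variable {T : H →L[ℂ] H} {x : H} {μ : Measure (AddCircle (1 : ℝ))}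

theorem IsElementaryMeasure.integral_fourier_eq_powerMoment (hμ : IsElementaryMeasure T x μ)
    (n : ℤ) : ∫ t, (fourier n t : ℂ) ∂μ = powerMoment T x n := by
  obtain ⟨k, rfl | rfl⟩ := n.eq_nat_or_neg
  · exact hμ k
  · rw [powerMoment_neg, powerMoment_natCast, ← hμ k, ← integral_conj]
    simp only [fourier_neg]

theorem summable_norm_smul_pow (hT : ‖T‖ ≤ 1) {a : ℕ → ℂ}
    (ha : Summable fun n => ‖a n‖) : Summable fun n => ‖a n • T ^ n‖ := by
  refine Summable.of_nonneg_of_le (fun _ => norm_nonneg _) (fun n => ?_) ha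
  rw [norm_smul]
  refine mul_le_of_le_one_right (norm_nonneg _) ?_
  rcases n.eq_zero_or_pos with rfl | hn
  · rw [pow_zero]; exact ContinuousLinearMap.norm_id_le
  · exact (norm_pow_le' T hn).trans (pow_le_one₀ (norm_nonneg _) hT)

/-- Since the Fourier coefficients of `μ` are the moments, the integral expands to the Toeplitz
form. This comparison with `L²(μ)` takes the place of a unitary dilation. -/
theorem IsElementaryMeasure.norm_sum_sq_le [IsFiniteMeasure μ] (hμ : IsElementaryMeasure T x μ) (hT : ‖T‖ ≤ 1)
    (N : ℕ) (a : ℕ → ℂ) :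
    ‖∑ i ∈ Finset.range N, a i • (T ^ i) x‖ ^ 2
      ≤ ∫ t, ‖∑ i ∈ Finset.range N, a i * fourier (i : ℤ) t‖ ^ 2 ∂μ := by
  refine (norm_sum_smul_pow_sq_le_toeplitzForm hT x N a).trans_eq ?_
  apply Complex.ofReal_injective
  rw [ofReal_re_toeplitzForm, integral_norm_sq_sum_fourier]
  simp only [hμ.integral_fourier_eq_powerMoment]
  rfl

theorem aeval_apply_eq_sum (T : H →L[ℂ] H) (p : Polynomial ℂ) (x : H) :
    Polynomial.aeval T p x = ∑ i ∈ Finset.range (p.natDegree + 1), p.coeff i • (T ^ i) x := by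
  rw [Polynomial.aeval_eq_sum_range]
  simp

theorem eval_fourier_eq_sum (p : Polynomial ℂ) (t : AddCircle (1 : ℝ)) :
    p.eval (fourier 1 t : ℂ)
      = ∑ i ∈ Finset.range (p.natDegree + 1), p.coeff i * fourier (i : ℤ) t := by
  rw [Polynomial.eval_eq_sum_range]
  simp only [fourier_natCast_eq_pow]

theorem IsElementaryMeasure.norm_aeval_sq_le [IsFiniteMeasure μ] (hμ : IsElementaryMeasure T x μ) (hT : ‖T‖ ≤ 1)
    (p : Polynomial ℂ) :
    ‖Polynomial.aeval T p x‖ ^ 2 ≤ ∫ t, ‖p.eval (fourier 1 t : ℂ)‖ ^ 2 ∂μ := by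
  simp only [aeval_apply_eq_sum, eval_fourier_eq_sum]
  exact hμ.norm_sum_sq_le hT _ _

theorem IsElementaryMeasure.inner_aeval [IsFiniteMeasure μ] (hμ : IsElementaryMeasure T x μ) (p : Polynomial ℂ) :
    inner ℂ x (Polynomial.aeval T p x) = ∫ t, p.eval (fourier 1 t : ℂ) ∂μ := by
  simp only [aeval_apply_eq_sum, eval_fourier_eq_sum]
  rw [integral_finsetSum _ fun i _ => Continuous.integrable_addCircle (by fun_prop), inner_sum]
  refine Finset.sum_congr rfl fun i _ => ?_
  rw [integral_const_mul, hμ i, inner_smul_right]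

theorem IsElementaryMeasure.measureReal_univ (hμ : IsElementaryMeasure T x μ) :
    μ.real Set.univ = ‖x‖ ^ 2 := by
  have h := hμ 0
  simp only [Nat.cast_zero, fourier_zero, pow_zero, one_apply_eq_self, integral_const,
    inner_self_eq_norm_sq_to_K] at h
  apply Complex.ofReal_injective
  simpa using h

theorem IsElementaryMeasure.norm_tsum_sq_le [CompleteSpace H] [IsFiniteMeasure μ]
    (hμ : IsElementaryMeasure T x μ)
    (hT : ‖T‖ ≤ 1) {a : ℕ → ℂ} (ha : Summable fun n => ‖a n‖) :
    ‖(∑' n, a n • T ^ n) x‖ ^ 2 ≤ ∫ t, ‖∑' n : ℕ, a n * fourier (n : ℤ) t‖ ^ 2 ∂μ := by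
  have h1 : Tendsto (fun N => ∑ i ∈ Finset.range N, a i • (T ^ i) x) atTop
      (𝓝 ((∑' n, a n • T ^ n) x)) := by
    have := ((ContinuousLinearMap.apply ℂ H x).continuous.tendsto _).comp
      (summable_norm_smul_pow hT ha).of_norm.hasSum.tendsto_sum_nat
    refine this.congr fun N => ?_
    simp
  exact le_of_tendsto_of_tendsto' (h1.norm.pow 2)
    (tendsto_integral_norm_sq_sum_fourier μ ha) fun N => hμ.norm_sum_sq_le hT N a

theorem IsElementaryMeasure.le_mul_norm_of_sq_le_integral [IsFiniteMeasure μ] (hμ : IsElementaryMeasure T x μ)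
    {s C : ℝ} (hC : 0 ≤ C) {f : AddCircle (1 : ℝ) → ℂ} (hf : ∀ t, ‖f t‖ ≤ C)
    (h : s ^ 2 ≤ ∫ t, ‖f t‖ ^ 2 ∂μ) : s ≤ C * ‖x‖ := by
  refine le_of_sq_le_sq (h.trans ?_) (by positivity)
  calc ∫ t, ‖f t‖ ^ 2 ∂μ ≤ ∫ _, C ^ 2 ∂μ := by
        refine integral_mono_of_nonneg (Eventually.of_forall fun t => by positivity)
          (integrable_const _) (Eventually.of_forall fun t => ?_)
        exact pow_le_pow_left₀ (norm_nonneg _) (hf t) 2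
    _ = (C * ‖x‖) ^ 2 := by
        rw [integral_const, hμ.measureReal_univ, smul_eq_mul]; ring

/-- **Von Neumann's inequality** for polynomials. -/
theorem norm_aeval_apply_le (hT : ‖T‖ ≤ 1) {p : Polynomial ℂ} {C : ℝ}
    (hp : ∀ t : AddCircle (1 : ℝ), ‖p.eval (fourier 1 t : ℂ)‖ ≤ C) (x : H) :
    ‖Polynomial.aeval T p x‖ ≤ C * ‖x‖ := by
  obtain ⟨μ, _, hμ⟩ := exists_measure_integral_fourier_eq_inner hT x
  have hμ : IsElementaryMeasure T x μ := hμ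
  exact hμ.le_mul_norm_of_sq_le_integral ((norm_nonneg _).trans (hp 0)) hp
    (hμ.norm_aeval_sq_le hT p)

/-- **Von Neumann's inequality** for absolutely convergent power series. -/
theorem norm_tsum_smul_pow_apply_le [CompleteSpace H] (hT : ‖T‖ ≤ 1) {a : ℕ → ℂ}
    (ha : Summable fun n => ‖a n‖) {C : ℝ}
    (hC : ∀ t : AddCircle (1 : ℝ), ‖∑' n : ℕ, a n * fourier (n : ℤ) t‖ ≤ C) (x : H) :
    ‖(∑' n, a n • T ^ n) x‖ ≤ C * ‖x‖ := by
  obtain ⟨μ, _, hμ⟩ := exists_measure_integral_fourier_eq_inner hT x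
  have hμ : IsElementaryMeasure T x μ := hμ
  exact hμ.le_mul_norm_of_sq_le_integral ((norm_nonneg _).trans (hC 0)) hC
    (hμ.norm_tsum_sq_le hT ha)

end VonNeumann

/-! ### Polynomials peaking on a null compact set -/

section PeakPolynomials

theorem integral_eval_fourier (p : Polynomial ℂ) :
    ∫ t, p.eval (fourier 1 t : ℂ) ∂(haarAddCircle (T := 1)) = p.eval 0 := by
  simp only [eval_fourier_eq_sum]
  rw [integral_finsetSum _ fun i _ => Continuous.integrable_addCircle (by fun_prop)]
  simp only [integral_const_mul, integral_fourier, ← Polynomial.coeff_zero_eq_eval_zero]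
  simp

theorem norm_eval_zero_le_of_norm_eval_fourier_le {p : Polynomial ℂ} {C : ℝ}
    (hp : ∀ t : AddCircle (1 : ℝ), ‖p.eval (fourier 1 t : ℂ)‖ ≤ C) : ‖p.eval 0‖ ≤ C := by
  rw [← integral_eval_fourier]
  simpa using norm_integral_le_of_norm_le_const (μ := haarAddCircle (T := 1))
    (Eventually.of_forall hp)

theorem continuous_eval_fourier (p : Polynomial ℂ) :
    Continuous fun t : AddCircle (1 : ℝ) => p.eval (fourier 1 t : ℂ) :=
  p.continuous.comp (fourier 1).continuous

theorem exists_norm_eval_fourier_le (p : Polynomial ℂ) :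
    ∃ C : ℝ, ∀ t : AddCircle (1 : ℝ), ‖p.eval (fourier 1 t : ℂ)‖ ≤ C := by
  obtain ⟨C, hC⟩ := isCompact_univ.exists_bound_of_continuousOn
    (continuous_eval_fourier p).continuousOn
  exact ⟨C, fun t => hC t trivial⟩

/-- If `Re F ≥ 0` on the circle, then `1 / (1 + F)` is a uniform limit of polynomials there. -/
theorem exists_polynomial_near_inv_one_add {F : Polynomial ℂ}
    (hF : ∀ t : AddCircle (1 : ℝ), 0 ≤ (F.eval (fourier 1 t : ℂ)).re) {δ : ℝ} (hδ : 0 < δ) :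
    ∃ s : Polynomial ℂ, ∀ t : AddCircle (1 : ℝ),
      ‖((1 + F) * s - 1).eval (fourier 1 t : ℂ)‖ ≤ δ := by
  obtain ⟨B, hB⟩ := exists_norm_eval_fourier_le F
  -- With `w = 1 - c (1 + F)` and `Re F ≥ 0`, one has `|w|² ≤ 1 - 2c + c² (1 + B²)`, which equals `1
  -- - c` for this `c`. Hence `1 / (1 + F) = c ∑ wⁱ` converges uniformly on the circle.
  set c : ℝ := 1 / (1 + B ^ 2) with hc
  have hc0 : 0 < c := by positivity
  have hcB : c * (1 + B ^ 2) = 1 := by rw [hc]; field_simp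
  have hc1 : c ≤ 1 := by nlinarith [mul_nonneg hc0.le (sq_nonneg B)]
  set w : Polynomial ℂ := 1 - Polynomial.C (c : ℂ) * (1 + F) with hw
  have hwn : ∀ t : AddCircle (1 : ℝ), ‖w.eval (fourier 1 t : ℂ)‖ ^ 2 ≤ 1 - c := by
    intro t
    have h1 := hF t
    have h2 : ‖F.eval (fourier 1 t : ℂ)‖ ^ 2 ≤ B ^ 2 := pow_le_pow_left₀ (norm_nonneg _) (hB t) 2
    rw [← Complex.normSq_eq_norm_sq, Complex.normSq_apply] at h2 ⊢
    simp only [hw, Polynomial.eval_sub, Polynomial.eval_mul, Polynomial.eval_add,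
      Polynomial.eval_one, Polynomial.eval_C, Complex.sub_re, Complex.sub_im, Complex.one_re,
      Complex.one_im, Complex.add_re, Complex.add_im, Complex.re_ofReal_mul,
      Complex.im_ofReal_mul]
    nlinarith [mul_nonneg (mul_nonneg hc0.le (sub_nonneg.2 hc1)) h1,
      mul_le_mul_of_nonneg_left h2 (sq_nonneg c)]
  have hρ : Real.sqrt (1 - c) < 1 := by
    rw [Real.sqrt_lt' one_pos]; linarith
  obtain ⟨N, hN⟩ := exists_pow_lt_of_lt_one hδ hρ
  refine ⟨Polynomial.C (c : ℂ) * ∑ i ∈ Finset.range N, w ^ i, fun t => ?_⟩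
  have hid : (1 + F) * (Polynomial.C (c : ℂ) * ∑ i ∈ Finset.range N, w ^ i) - 1 = -w ^ N := by
    have := mul_neg_geom_sum w N
    have h1w : 1 - w = Polynomial.C (c : ℂ) * (1 + F) := by rw [hw]; ring
    rw [h1w] at this
    linear_combination this
  rw [hid, Polynomial.eval_neg, norm_neg, Polynomial.eval_pow, norm_pow]
  refine le_trans ?_ hN.le
  exact pow_le_pow_left₀ (norm_nonneg _) (Real.le_sqrt_of_sq_le (hwn t)) N

/-- The real part of a trigonometric polynomial is the real part of an analytic polynomial. -/
theorem exists_polynomial_re_eq {P : C(AddCircle (1 : ℝ), ℂ)}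
    (hP : P ∈ Submodule.span ℂ (Set.range (fourier (T := 1)))) :
    ∃ F : Polynomial ℂ, ∀ t, (F.eval (fourier 1 t : ℂ)).re = (P t).re := by
  -- Real parts do not commute with complex scalars; carrying an arbitrary factor `c` makes the
  -- induction over the complex span go through.
  suffices h : ∀ c : ℂ, ∃ F : Polynomial ℂ, ∀ t, (F.eval (fourier 1 t : ℂ)).re = (c * P t).re by
    simpa using h 1
  induction hP using Submodule.span_induction with
  | mem f hf =>
    obtain ⟨n, rfl⟩ := hf
    intro c
    obtain ⟨k, rfl | rfl⟩ := n.eq_nat_or_neg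
    · exact ⟨Polynomial.C c * Polynomial.X ^ k, fun t => by
        rw [fourier_natCast_eq_pow, Polynomial.eval_mul, Polynomial.eval_C, Polynomial.eval_pow,
          Polynomial.eval_X]⟩
    · refine ⟨Polynomial.C (conj c) * Polynomial.X ^ k, fun t => ?_⟩
      rw [fourier_neg, ← Complex.conj_re, fourier_natCast_eq_pow]
      simp
  | zero => exact fun c => ⟨0, by simp⟩
  | add f g _ _ hf hg =>
    intro c
    obtain ⟨F, hF⟩ := hf c
    obtain ⟨G, hG⟩ := hg c
    exact ⟨F + G, fun t => by
      rw [Polynomial.eval_add, Complex.add_re, hF, hG, ContinuousMap.add_apply, mul_add,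
        Complex.add_re]⟩
  | smul a f _ hf =>
    intro c
    obtain ⟨F, hF⟩ := hf (c * a)
    exact ⟨F, fun t => by rw [hF]; simp [mul_assoc]⟩

/-- A polynomial with nonnegative real part on the circle, with real part large on a given
null compact set, and small at the origin. -/
theorem exists_polynomial_re_ge {E : Set (AddCircle (1 : ℝ))} (hE : IsCompact E)
    (hE0 : haarAddCircle E = 0) {K ε : ℝ} (hK : 0 < K) (hε : 0 < ε) :
    ∃ F : Polynomial ℂ, (∀ t : AddCircle (1 : ℝ), 0 ≤ (F.eval (fourier 1 t : ℂ)).re) ∧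
      (∀ t ∈ E, K ≤ (F.eval (fourier 1 t : ℂ)).re) ∧ ‖F.eval 0‖ ≤ ε := by
  obtain ⟨U, hEU, hU, hUm⟩ := E.exists_isOpen_lt_of_lt (μ := haarAddCircle)
    (ENNReal.ofReal (ε / (2 * K))) (by rw [hE0]; exact ENNReal.ofReal_pos.2 (by positivity))
  obtain ⟨h, hh0, hh1, hh⟩ := exists_continuous_zero_one_of_isClosed hU.isClosed_compl hE.isClosed
    (Set.disjoint_compl_left_iff_subset.2 hEU)
  have hδ : 0 < ε / 4 := by positivity
  -- The shift `ε / 4` equals the approximation error allowed below, so the approximant keeps a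
  -- nonnegative real part.
  set g : C(AddCircle (1 : ℝ), ℂ) :=
    ⟨fun t => ((K * h t + ε / 4 : ℝ) : ℂ), by fun_prop⟩ with hg
  have hgmem : g ∈ (Submodule.span ℂ (Set.range (fourier (T := 1)))).topologicalClosure := by
    rw [span_fourier_closure_eq_top]; trivial
  obtain ⟨P, hP, hgP⟩ := Metric.mem_closure_iff.1 hgmem (ε / 4) hδ
  obtain ⟨F, hF⟩ := exists_polynomial_re_eq hP
  have hPre : ∀ t, |K * h t + ε / 4 - (P t).re| ≤ ε / 4 := by
    intro t
    have h1 := (ContinuousMap.dist_apply_le_dist (f := g) (g := P) t).trans hgP.le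
    rw [dist_eq_norm] at h1
    have h2 := (Complex.abs_re_le_norm _).trans h1
    simpa only [hg, ContinuousMap.coe_mk, Complex.sub_re, Complex.ofReal_re] using h2
  have hre0 : (F.eval 0).re = ∫ t, (P t).re ∂haarAddCircle := by
    rw [← integral_eval_fourier]
    have := integral_re (μ := haarAddCircle (T := 1)) (𝕜 := ℂ)
      (Continuous.integrable_addCircle (continuous_eval_fourier F))
    simp only [RCLike.re_eq_complex_re] at this
    rw [← this]
    simp only [hF]
  have hhle : ∀ t, h t ≤ U.indicator (fun _ => (1 : ℝ)) t := by
    intro t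
    by_cases ht : t ∈ U
    · rw [Set.indicator_of_mem ht]; exact (hh t).2
    · rw [Set.indicator_of_notMem ht]; exact (hh0 ht).le
  have hUreal : haarAddCircle.real U ≤ ε / (2 * K) :=
    ENNReal.toReal_le_of_le_ofReal (by positivity) hUm.le
  have hup : (F.eval 0).re ≤ ε := by
    rw [hre0]
    calc ∫ t, (P t).re ∂haarAddCircle
        ≤ ∫ t, (K * U.indicator (fun _ => (1 : ℝ)) t + ε / 2) ∂haarAddCircle := by
          refine integral_mono (Continuous.integrable_addCircle (by fun_prop))
            ((((integrable_const _).indicator hU.measurableSet).const_mul K).add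
              (integrable_const _)) fun t => ?_
          have h1 := (abs_le.1 (hPre t)).1
          have h2 := mul_le_mul_of_nonneg_left (hhle t) hK.le
          simp only
          linarith
      _ = K * haarAddCircle.real U + ε / 2 := by
          rw [integral_add (((integrable_const _).indicator hU.measurableSet).const_mul K)
            (integrable_const _), integral_const_mul, integral_indicator hU.measurableSet]
          simp
      _ ≤ K * (ε / (2 * K)) + ε / 2 := by gcongr
      _ = ε := by field_simp; ring
  have hlow : 0 ≤ (F.eval 0).re := by
    rw [hre0]
    refine integral_nonneg fun t => ?_
    have h1 := (abs_le.1 (hPre t)).2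
    have h2 := mul_nonneg hK.le (hh t).1
    simp only [Pi.zero_apply]
    linarith
  have hFre : ∀ z : ℂ, ((F - Polynomial.C (((F.eval 0).im : ℂ) * Complex.I)).eval z).re
      = (F.eval z).re := by
    intro z; simp
  -- Subtracting an imaginary constant makes the value at `0` real without changing real parts; that
  -- value is then the mean of `Re P`, hence at most `ε`.
  refine ⟨F - Polynomial.C (((F.eval 0).im : ℂ) * Complex.I), fun t => ?_, fun t ht => ?_, ?_⟩
  · rw [hFre, hF]
    have h1 := (abs_le.1 (hPre t)).2
    have h2 := mul_nonneg hK.le (hh t).1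
    linarith
  · rw [hFre, hF]
    have h1 := (abs_le.1 (hPre t)).2
    have h2 : h t = 1 := hh1 ht
    rw [h2] at h1
    linarith
  · have : (F - Polynomial.C (((F.eval 0).im : ℂ) * Complex.I)).eval 0
        = ((F.eval 0).re : ℂ) := by
      rw [Polynomial.eval_sub, Polynomial.eval_C]
      nth_rewrite 1 [← Complex.re_add_im (F.eval 0)]
      ring
    rw [this, Complex.norm_real, Real.norm_of_nonneg hlow]
    exact hup

/-- The map `w ↦ w / (1 + w)` sends the right half-plane into the disk with diameter `[0, 1]`, where
`|f|² ≤ Re f`. This reduces a mean square to the mean of a real part, that is, to a value at the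
origin. -/
theorem norm_div_one_add_sq_le_re {w : ℂ} (hw : 0 ≤ w.re) :
    ‖w / (1 + w)‖ ^ 2 ≤ (w / (1 + w)).re := by
  have hpos : 0 < Complex.normSq (1 + w) := by
    rw [Complex.normSq_apply]
    simp only [Complex.add_re, Complex.one_re, Complex.add_im, Complex.one_im]
    nlinarith [sq_nonneg w.im]
  rw [← Complex.normSq_eq_norm_sq, Complex.normSq_div, Complex.div_re, ← add_div]
  refine div_le_div_of_nonneg_right ?_ hpos.le
  rw [Complex.normSq_apply]
  simp only [Complex.add_re, Complex.one_re, Complex.add_im, Complex.one_im]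
  nlinarith

/-- Polynomials `X * q` bounded by one on the circle, close to `1` on a given null compact set and
small in mean square. -/
theorem exists_peak_polynomial {E : Set (AddCircle (1 : ℝ))} (hE : IsCompact E)
    (hE0 : haarAddCircle E = 0) {ε : ℝ} (hε : 0 < ε) :
    ∃ q : Polynomial ℂ, (∀ t : AddCircle (1 : ℝ), ‖q.eval (fourier 1 t : ℂ)‖ ≤ 1) ∧
      (∀ t ∈ E, ‖1 - (Polynomial.X * q).eval (fourier 1 t : ℂ)‖ ≤ ε) ∧
      ∫ t, ‖q.eval (fourier 1 t : ℂ)‖ ^ 2 ∂(haarAddCircle (T := 1)) ≤ ε := by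
  -- The worst of the final estimates is the mean square, `2 · 8η + 32η = 48η`; on `E` only `2η + 4η
  -- + 5η` is needed.
  obtain ⟨η, hη, hη1, hηε⟩ : ∃ η : ℝ, 0 < η ∧ η ≤ 1 / 2 ∧ 48 * η ≤ ε :=
    ⟨min (1 / 2) (ε / 48), by positivity, min_le_left _ _, by
      have := min_le_right (1 / 2) (ε / 48); linarith⟩
  obtain ⟨F, hF, hFE, hF0⟩ := exists_polynomial_re_ge hE hE0 (one_div_pos.2 hη) hη
  obtain ⟨s, hs⟩ := exists_polynomial_near_inv_one_add hF hη
  have hre : ∀ w : ℂ, 1 + w.re ≤ ‖1 + w‖ := fun w => by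
    simpa using Complex.re_le_norm (1 + w)
  -- As `s` approximates `1 / (1 + F)`, `p` approximates `F / (1 + F)`: near `1` where `Re F` is
  -- large, and small at the origin.
  set p : Polynomial ℂ := 1 - s with hp
  have hpf : ∀ t : AddCircle (1 : ℝ), ‖p.eval (fourier 1 t : ℂ)
      - F.eval (fourier 1 t : ℂ) / (1 + F.eval (fourier 1 t : ℂ))‖ ≤ η := by
    intro t
    have h1 := hs t
    have h2 := hF t
    simp only [hp, Polynomial.eval_sub, Polynomial.eval_mul, Polynomial.eval_add,
      Polynomial.eval_one] at h1 ⊢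
    set w := F.eval (fourier 1 t : ℂ)
    have h3 : 1 ≤ ‖1 + w‖ := by linarith [hre w]
    have h4 : 1 + w ≠ 0 := norm_pos_iff.1 (by linarith)
    have h5 : 1 - s.eval (fourier 1 t : ℂ) - w / (1 + w)
        = -((1 + w) * s.eval (fourier 1 t : ℂ) - 1) / (1 + w) := by
      field_simp; ring
    rw [h5, norm_div, norm_neg]
    exact (div_le_self (norm_nonneg _) h3).trans h1
  have hf1 : ∀ t : AddCircle (1 : ℝ),
      ‖F.eval (fourier 1 t : ℂ) / (1 + F.eval (fourier 1 t : ℂ))‖ ≤ 1 := by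
    intro t
    have h1 := norm_div_one_add_sq_le_re (hF t)
    have h2 := h1.trans (Complex.re_le_norm _)
    nlinarith [norm_nonneg (F.eval (fourier 1 t : ℂ) / (1 + F.eval (fourier 1 t : ℂ)))]
  have hp1 : ∀ t : AddCircle (1 : ℝ), ‖p.eval (fourier 1 t : ℂ)‖ ≤ 1 + η := by
    intro t
    have := norm_add_le (p.eval (fourier 1 t : ℂ)
      - F.eval (fourier 1 t : ℂ) / (1 + F.eval (fourier 1 t : ℂ)))
      (F.eval (fourier 1 t : ℂ) / (1 + F.eval (fourier 1 t : ℂ)))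
    rw [sub_add_cancel] at this
    linarith [hpf t, hf1 t]
  have hpsq : ∀ t : AddCircle (1 : ℝ), ‖p.eval (fourier 1 t : ℂ)‖ ^ 2
      ≤ (p.eval (fourier 1 t : ℂ)).re + 4 * η := by
    intro t
    have h1 := norm_div_one_add_sq_le_re (hF t)
    have h2 := hpf t
    have h3 := hf1 t
    set f := F.eval (fourier 1 t : ℂ) / (1 + F.eval (fourier 1 t : ℂ))
    set P := p.eval (fourier 1 t : ℂ)
    have h4 : ‖P‖ ≤ ‖f‖ + η := by
      have := norm_add_le (P - f) f
      rw [sub_add_cancel] at this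
      linarith
    have h5 : |(P - f).re| ≤ η := (Complex.abs_re_le_norm _).trans h2
    rw [Complex.sub_re] at h5
    have h6 := (abs_le.1 h5).1
    nlinarith [norm_nonneg P, norm_nonneg f]
  have hpE : ∀ t ∈ E, ‖1 - p.eval (fourier 1 t : ℂ)‖ ≤ 2 * η := by
    intro t ht
    have h1 := hpf t
    have h2 := hFE t ht
    set w := F.eval (fourier 1 t : ℂ)
    have h3 : 1 / η ≤ ‖1 + w‖ := by linarith [hre w]
    have h4 : 1 + w ≠ 0 := norm_pos_iff.1 (lt_of_lt_of_le (by positivity) h3)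
    have h5 : ‖1 / (1 + w)‖ ≤ η := by
      rw [norm_div, norm_one]
      exact (one_div_le hη (norm_pos_iff.2 h4)).1 h3
    have h6 : 1 - p.eval (fourier 1 t : ℂ)
        = 1 / (1 + w) - (p.eval (fourier 1 t : ℂ) - w / (1 + w)) := by
      field_simp; ring
    rw [h6]
    exact (norm_sub_le _ _).trans (by linarith)
  have hp0 : ‖p.eval 0‖ ≤ 4 * η := by
    have h1 := norm_eval_zero_le_of_norm_eval_fourier_le hs
    have h2 : (1 + F.eval 0) * p.eval 0 = F.eval 0 - ((1 + F) * s - 1).eval 0 := by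
      simp only [hp, Polynomial.eval_sub, Polynomial.eval_mul, Polynomial.eval_add,
        Polynomial.eval_one]
      ring
    have h3 : ‖(1 + F.eval 0) * p.eval 0‖ ≤ 2 * η := by
      rw [h2]; exact (norm_sub_le _ _).trans (by linarith)
    have h4 : 1 / 2 ≤ ‖1 + F.eval 0‖ := by
      have := norm_sub_norm_le (1 : ℂ) (-F.eval 0)
      rw [norm_one, norm_neg, sub_neg_eq_add] at this
      linarith
    rw [norm_mul] at h3
    nlinarith [norm_nonneg (p.eval 0)]
  have hpint : ∫ t, ‖p.eval (fourier 1 t : ℂ)‖ ^ 2 ∂(haarAddCircle (T := 1)) ≤ 8 * η := by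
    have hcont := continuous_eval_fourier p
    calc ∫ t, ‖p.eval (fourier 1 t : ℂ)‖ ^ 2 ∂(haarAddCircle (T := 1))
        ≤ ∫ t, ((p.eval (fourier 1 t : ℂ)).re + 4 * η) ∂(haarAddCircle (T := 1)) :=
          integral_mono (Continuous.integrable_addCircle (by fun_prop))
            (Continuous.integrable_addCircle (by fun_prop)) hpsq
      _ = (p.eval 0).re + 4 * η := by
          rw [integral_add (Continuous.integrable_addCircle (by fun_prop)) (integrable_const _),
            ← integral_eval_fourier]
          have := integral_re (μ := haarAddCircle (T := 1)) (𝕜 := ℂ)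
            (Continuous.integrable_addCircle hcont)
          simp only [RCLike.re_eq_complex_re] at this
          rw [this]
          simp
      _ ≤ 8 * η := by linarith [(Complex.re_le_norm (p.eval 0)).trans hp0]
  have hk : ‖((1 + 5 * η : ℝ) : ℂ)‖ = 1 + 5 * η := by
    rw [Complex.norm_real, Real.norm_of_nonneg (by positivity)]
  have hkinv : ‖((1 + 5 * η : ℝ) : ℂ)⁻¹‖ ≤ 1 := by
    rw [norm_inv, hk]; exact inv_le_one_of_one_le₀ (by linarith)
  have hk0 : ((1 + 5 * η : ℝ) : ℂ) ≠ 0 := norm_pos_iff.1 (by rw [hk]; positivity)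
  -- Here `X * q = (p - p(0)) / (1 + 5η)`; the denominator dominates `|p| + |p(0)| ≤ (1 + η) + 4η`
  -- on the circle.
  set q : Polynomial ℂ := Polynomial.C ((1 + 5 * η : ℝ) : ℂ)⁻¹ * p.divX with hq
  have hXq : ∀ z : ℂ, (Polynomial.X * q).eval z
      = ((1 + 5 * η : ℝ) : ℂ)⁻¹ * (p.eval z - p.eval 0) := by
    intro z
    have h1 := congrArg (Polynomial.eval z) (Polynomial.divX_mul_X_add p)
    simp only [Polynomial.eval_add, Polynomial.eval_mul, Polynomial.eval_X,
      Polynomial.eval_C, Polynomial.coeff_zero_eq_eval_zero] at h1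
    rw [hq, Polynomial.eval_mul, Polynomial.eval_mul, Polynomial.eval_X, Polynomial.eval_C, ← h1]
    ring
  have hqn : ∀ t : AddCircle (1 : ℝ), ‖q.eval (fourier 1 t : ℂ)‖
      = ‖((1 + 5 * η : ℝ) : ℂ)⁻¹‖ * ‖p.eval (fourier 1 t : ℂ) - p.eval 0‖ := by
    intro t
    rw [← norm_mul, ← hXq, mul_comm Polynomial.X, Polynomial.eval_mul_X, norm_mul,
      norm_fourier_apply, mul_one]
  refine ⟨q, fun t => ?_, fun t ht => ?_, ?_⟩
  · rw [hqn, norm_inv, hk, inv_mul_le_iff₀ (by positivity), mul_one]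
    exact (norm_sub_le _ _).trans (by linarith [hp1 t])
  · have h1 : 1 - (Polynomial.X * q).eval (fourier 1 t : ℂ) = ((1 + 5 * η : ℝ) : ℂ)⁻¹
        * ((1 - p.eval (fourier 1 t : ℂ)) + (p.eval 0 + (5 * η : ℝ))) := by
      rw [hXq]
      have : (1 : ℂ) = ((1 + 5 * η : ℝ) : ℂ)⁻¹ * ((1 + 5 * η : ℝ) : ℂ) := (inv_mul_cancel₀ hk0).symm
      nth_rewrite 1 [this]
      push_cast
      ring
    rw [h1, norm_mul]
    refine (mul_le_of_le_one_left (norm_nonneg _) hkinv).trans ?_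
    have h2 : ‖((5 * η : ℝ) : ℂ)‖ = 5 * η := by
      rw [Complex.norm_real, Real.norm_of_nonneg (by positivity)]
    have h3 := norm_add_le (1 - p.eval (fourier 1 t : ℂ)) (p.eval 0 + (5 * η : ℝ))
    have h4 := norm_add_le (p.eval 0) ((5 * η : ℝ) : ℂ)
    linarith [hpE t ht]
  · have hcont := continuous_eval_fourier p
    have hcontq := continuous_eval_fourier q
    calc ∫ t, ‖q.eval (fourier 1 t : ℂ)‖ ^ 2 ∂(haarAddCircle (T := 1))
        ≤ ∫ t, (2 * ‖p.eval (fourier 1 t : ℂ)‖ ^ 2 + 32 * η) ∂(haarAddCircle (T := 1)) := by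
          refine integral_mono (Continuous.integrable_addCircle (by fun_prop))
            (Continuous.integrable_addCircle (by fun_prop)) fun t => ?_
          have h1 : ‖q.eval (fourier 1 t : ℂ)‖ ≤ ‖p.eval (fourier 1 t : ℂ)‖ + 4 * η := by
            rw [hqn]
            refine (mul_le_of_le_one_left (norm_nonneg _) hkinv).trans ?_
            exact (norm_sub_le _ _).trans (by linarith)
          have h2 := pow_le_pow_left₀ (norm_nonneg _) h1 2
          simp only
          nlinarith [sq_nonneg (‖p.eval (fourier 1 t : ℂ)‖ - 4 * η)]
      _ = 2 * ∫ t, ‖p.eval (fourier 1 t : ℂ)‖ ^ 2 ∂(haarAddCircle (T := 1)) + 32 * η := by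
          rw [integral_add (Continuous.integrable_addCircle (by fun_prop)) (integrable_const _),
            integral_const_mul]
          simp
      _ ≤ ε := by linarith

end PeakPolynomials

/-! ### Transfer of convergence to absolutely continuous measures -/

section AbsolutelyContinuousConvergence

/-- For uniformly bounded functions, mean square convergence to zero with respect to a measure
implies convergence to zero in mean with respect to any absolutely continuous finite measure. -/
theorem tendsto_integral_norm_of_absolutelyContinuous {α ι E : Type*} [MeasurableSpace α]
    [NormedAddCommGroup E] {m ν : Measure α} [IsFiniteMeasure m] [IsFiniteMeasure ν]
    (hν : ν ≪ m) {l : Filter ι} [l.IsCountablyGenerated] {φ : ι → α → E}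
    (hφ : ∀ i, StronglyMeasurable (φ i)) {B : ℝ} (hB : ∀ i a, ‖φ i a‖ ≤ B)
    (h : Tendsto (fun i => ∫ a, ‖φ i a‖ ^ 2 ∂m) l (𝓝 0)) :
    Tendsto (fun i => ∫ a, ‖φ i a‖ ∂ν) l (𝓝 0) := by
  refine tendsto_of_seq_tendsto fun u hu => ?_
  -- Mean square convergence gives almost everywhere convergence only along a subsequence, so the
  -- claim is reduced to a further subsequence of each sequence.
  refine tendsto_of_subseq_tendsto fun ns hns => ?_
  have h1 : Tendsto (fun n => ∫ a, ‖φ (u (ns n)) a‖ ^ 2 ∂m) atTop (𝓝 0) :=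
    h.comp (hu.comp hns)
  have hsq : ∀ i, StronglyMeasurable fun a => ‖φ i a‖ ^ 2 := fun i => (hφ i).norm.pow 2
  have hint : ∀ i, Integrable (fun a => ‖φ i a‖ ^ 2) m := fun i =>
    Integrable.of_bound (hsq i).aestronglyMeasurable (B ^ 2) (Eventually.of_forall fun a => by
      rw [Real.norm_of_nonneg (by positivity)]
      exact pow_le_pow_left₀ (norm_nonneg _) (hB i a) 2)
  have h2 : TendstoInMeasure m (fun n a => ‖φ (u (ns n)) a‖ ^ 2) atTop fun _ => 0 := by
    refine tendstoInMeasure_of_tendsto_eLpNorm (p := 1) one_ne_zero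
      (fun n => (hsq _).aestronglyMeasurable) aestronglyMeasurable_const ?_
    have h3 : ∀ n, eLpNorm ((fun a => ‖φ (u (ns n)) a‖ ^ 2) - fun _ => (0 : ℝ)) 1 m
        = ENNReal.ofReal (∫ a, ‖φ (u (ns n)) a‖ ^ 2 ∂m) := by
      intro n
      rw [eLpNorm_one_eq_lintegral_enorm, ofReal_integral_eq_lintegral_ofReal (hint _)
        (Eventually.of_forall fun a => by positivity)]
      refine lintegral_congr fun a => ?_
      rw [Pi.sub_apply, sub_zero, Real.enorm_of_nonneg (by positivity)]
    simp only [h3]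
    simpa using ENNReal.tendsto_ofReal h1
  obtain ⟨ms, -, hms⟩ := h2.exists_seq_tendsto_ae
  refine ⟨ms, ?_⟩
  rw [← integral_zero α ℝ (μ := ν)]
  refine tendsto_integral_of_dominated_convergence (fun _ => B)
    (fun n => (hφ _).norm.aestronglyMeasurable) (integrable_const _)
    (fun n => Eventually.of_forall fun a => by rw [norm_norm]; exact hB _ a) ?_
  filter_upwards [hν.ae_le hms] with a ha
  have := (Real.continuous_sqrt.tendsto _).comp ha
  simpa [Function.comp_def, Real.sqrt_sq] using this

end AbsolutelyContinuousConvergence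

/-! ### A reducing subspace on which the contraction is unitary -/

section ReducingSubspace

variable {H : Type*} [NormedAddCommGroup H] [InnerProductSpace ℂ H]

theorem aeval_apply_comm (T : H →L[ℂ] H) (p r : Polynomial ℂ) (v : H) :
    Polynomial.aeval T p (Polynomial.aeval T r v)
      = Polynomial.aeval T r (Polynomial.aeval T p v) := by
  rw [← mul_apply_eq_comp, ← mul_apply_eq_comp, ← map_mul, ← map_mul,
    mul_comm]

theorem aeval_apply_self_comm (T : H →L[ℂ] H) (p : Polynomial ℂ) (v : H) :
    Polynomial.aeval T p (T v) = T (Polynomial.aeval T p v) := by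
  simpa using aeval_apply_comm T p Polynomial.X v

theorem aeval_X_mul_apply (T : H →L[ℂ] H) (p : Polynomial ℂ) (v : H) :
    Polynomial.aeval T (Polynomial.X * p) v = T (Polynomial.aeval T p v) := by
  rw [map_mul, Polynomial.aeval_X, mul_apply_eq_comp]

/-- A contraction preserves inner products with vectors whose norm it preserves. -/
theorem inner_map_map_of_norm_map_eq [CompleteSpace H] {T : H →L[ℂ] H} (hT : ‖T‖ ≤ 1) {u : H}
    (hu : ‖T u‖ = ‖u‖) (w : H) : inner ℂ (T u) (T w) = inner ℂ u w := by
  have h1 : ‖T.adjoint (T u)‖ ≤ ‖u‖ := by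
    refine (T.adjoint.le_of_opNorm_le (c := 1) ?_ _).trans ?_
    · rwa [LinearIsometryEquiv.norm_map]
    · rw [one_mul, hu]
  -- Expanding, `‖T*T u - u‖² = ‖T*T u‖² - 2 ‖T u‖² + ‖u‖² ≤ 0`.
  have h2 : T.adjoint (T u) - u = 0 := by
    rw [← norm_eq_zero, ← sq_eq_zero_iff]
    refine le_antisymm ?_ (sq_nonneg _)
    rw [@norm_sub_sq ℂ, ContinuousLinearMap.adjoint_inner_left, inner_self_eq_norm_sq (𝕜 := ℂ), hu]
    nlinarith [norm_nonneg (T.adjoint (T u))]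
  rw [← ContinuousLinearMap.adjoint_inner_left, sub_eq_zero.1 h2]

/-- If contractions `Sₖ` commute with `T`, then `T` is unitary on the vectors fixed in the limit by
`T Sₖ`; hence there are none if `T` is completely non-unitary. -/
theorem IsCNUContraction.eq_zero_of_tendsto [CompleteSpace H] {T : H →L[ℂ] H}
    (hT : IsCNUContraction T) {S : ℕ → H →L[ℂ] H} (hS : ∀ k v, ‖S k v‖ ≤ ‖v‖)
    (hST : ∀ k v, S k (T v) = T (S k v)) (hSS : ∀ j k v, S j (S k v) = S k (S j v))
    {v : H} (hv : Tendsto (fun k => T (S k v)) atTop (𝓝 v)) : v = 0 := by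
  obtain ⟨hT1, hT2⟩ := hT
  have hTle : ∀ v, ‖T v‖ ≤ ‖v‖ := fun v => (T.le_of_opNorm_le hT1 v).trans_eq (one_mul _)
  let M : Submodule ℂ H :=
    { carrier := {v | Tendsto (fun k => T (S k v)) atTop (𝓝 v)}
      add_mem' := fun {a b} ha hb => by
        simpa only [Set.mem_ofPred_eq, map_add] using Tendsto.add ha hb
      zero_mem' := by simp
      smul_mem' := fun c a ha => by
        simpa only [Set.mem_ofPred_eq, map_smul] using Tendsto.const_smul ha c }
  have hMdef : ∀ v, v ∈ M ↔ Tendsto (fun k => T (S k v)) atTop (𝓝 v) := fun v => Iff.rfl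
  have hMclosed : IsClosed (M : Set H) := by
    refine isClosed_of_closure_subset fun v hv => ?_
    rw [SetLike.mem_coe, hMdef, Metric.tendsto_atTop]
    intro ε hε
    obtain ⟨w, hw, hvw⟩ := Metric.mem_closure_iff.1 hv (ε / 3) (by positivity)
    obtain ⟨N, hN⟩ := Metric.tendsto_atTop.1 ((hMdef w).1 hw) (ε / 3) (by positivity)
    refine ⟨N, fun k hk => ?_⟩
    have h1 := hN k hk
    have h2 : dist (T (S k v)) (T (S k w)) ≤ dist v w := by
      rw [dist_eq_norm, dist_eq_norm, ← map_sub, ← map_sub]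
      exact (hTle _).trans (hS _ _)
    have h3 := dist_triangle4 (T (S k v)) (T (S k w)) w v
    rw [dist_comm w v] at h3
    linarith
  have hMT : ∀ v ∈ M, T v ∈ M := by
    intro v hv
    rw [hMdef]
    simp only [hST]
    exact (T.continuous.tendsto _).comp ((hMdef v).1 hv)
  have hMS : ∀ j, ∀ v ∈ M, S j v ∈ M := by
    intro j v hv
    rw [hMdef]
    simp only [hSS _ j, ← hST j]
    exact ((S j).continuous.tendsto _).comp ((hMdef v).1 hv)
  -- By commutation `‖T Sₖ v‖ = ‖Sₖ T v‖ ≤ ‖T v‖`, and the left side tends to `‖v‖`.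
  have hiso : ∀ v ∈ M, ‖T v‖ = ‖v‖ := by
    intro v hv
    refine le_antisymm (hTle v) ?_
    refine le_of_tendsto ((hMdef v).1 hv).norm (Eventually.of_forall fun k => ?_)
    rw [← hST]
    exact hS _ _
  -- The preimage is `lim Sₖ v`: `T` is isometric on `M`, so convergence of `T Sₖ v` makes `Sₖ v`
  -- Cauchy.
  have hsurj : ∀ v ∈ M, ∃ u ∈ M, T u = v := by
    intro v hv
    have hc : CauchySeq fun k => S k v := by
      have h1 : CauchySeq fun k => T (S k v) := ((hMdef v).1 hv).cauchySeq
      rw [Metric.cauchySeq_iff] at h1 ⊢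
      intro ε hε
      obtain ⟨N, hN⟩ := h1 ε hε
      refine ⟨N, fun j hj k hk => ?_⟩
      have h2 := hN j hj k hk
      rwa [dist_eq_norm, ← map_sub, hiso _ (M.sub_mem (hMS j v hv) (hMS k v hv)),
        ← dist_eq_norm] at h2
    obtain ⟨u, hu⟩ := cauchySeq_tendsto_of_complete hc
    exact ⟨u, hMclosed.mem_of_tendsto hu (Eventually.of_forall fun k => hMS k v hv),
      tendsto_nhds_unique ((T.continuous.tendsto _).comp hu) ((hMdef v).1 hv)⟩
  have hperp : ∀ w ∈ Mᗮ, T w ∈ Mᗮ := by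
    intro w hw
    rw [Submodule.mem_orthogonal] at hw ⊢
    intro v hv
    obtain ⟨u, hu, rfl⟩ := hsurj v hv
    rw [inner_map_map_of_norm_map_eq hT1 (hiso u hu)]
    exact hw u hu
  by_contra hv0
  refine hT2 M hMclosed (fun hM => hv0 ?_) hMT hperp ⟨hiso, hsurj⟩
  have : v ∈ M := hv
  rwa [hM, Submodule.mem_bot] at this

end ReducingSubspace

/-! ### Absolute continuity of elementary measures -/

section AbsoluteContinuity

variable {H : Type*} [NormedAddCommGroup H] [InnerProductSpace ℂ H] [CompleteSpace H]

/-- Polynomials `X * qₖ`, bounded by one on the circle, tending to one on a null set carrying the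
singular part of `μ` and to zero with respect to the absolutely continuous part. -/
theorem exists_seq_polynomial_separating (μ : Measure (AddCircle (1 : ℝ))) [IsFiniteMeasure μ] :
    ∃ q : ℕ → Polynomial ℂ, (∀ k (t : AddCircle (1 : ℝ)), ‖(q k).eval (fourier 1 t : ℂ)‖ ≤ 1) ∧
      Tendsto (fun k => ∫ t, ‖1 - (Polynomial.X * q k).eval (fourier 1 t : ℂ)‖
        ∂(μ.singularPart haarAddCircle)) atTop (𝓝 0) ∧
      Tendsto (fun k => ∫ t, ‖(Polynomial.X * q k).eval (fourier 1 t : ℂ)‖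
        ∂(haarAddCircle.withDensity (μ.rnDeriv haarAddCircle))) atTop (𝓝 0) := by
  set σ := μ.singularPart haarAddCircle with hσ
  obtain ⟨S, hS, hS0, hSm⟩ : ∃ S, MeasurableSet S ∧ σ Sᶜ = 0 ∧ haarAddCircle S = 0 := by
    obtain ⟨S, hS, h1, h2⟩ := Measure.mutuallySingular_singularPart μ haarAddCircle
    exact ⟨Sᶜ, hS.compl, by rwa [compl_compl], h2⟩
  -- Peak polynomials need compact sets, so the Haar-null carrier `S` of `σ` is exhausted from
  -- inside.
  have hex : ∀ k : ℕ, ∃ E ⊆ S, IsCompact E ∧ σ (S \ E) < ENNReal.ofReal (1 / ((k : ℝ) + 1)) :=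
    fun k => hS.exists_isCompact_sdiff_lt (measure_ne_top _ _)
      (ENNReal.ofReal_pos.2 (by positivity)).ne'
  choose E hES hE hEσ using hex
  have hε : ∀ k : ℕ, (0 : ℝ) < 1 / ((k : ℝ) + 1) := fun k => by positivity
  choose q hq1 hqE hqm using fun k =>
    exists_peak_polynomial (hE k) (measure_mono_null (hES k) hSm) (hε k)
  have hXq : ∀ k (t : AddCircle (1 : ℝ)), ‖(Polynomial.X * q k).eval (fourier 1 t : ℂ)‖
      = ‖(q k).eval (fourier 1 t : ℂ)‖ := fun k t => by
    rw [mul_comm, Polynomial.eval_mul_X, norm_mul, norm_fourier_apply, mul_one]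
  have hlim := tendsto_one_div_add_atTop_nhds_zero_nat (𝕜 := ℝ)
  refine ⟨q, hq1, ?_, ?_⟩
  · refine squeeze_zero (g := fun k : ℕ => (1 / ((k : ℝ) + 1)) * (σ.real Set.univ + 2))
      (fun k => integral_nonneg fun t => norm_nonneg _) (fun k => ?_)
      (by simpa using hlim.mul_const (σ.real Set.univ + 2))
    have hEc : σ.real (E k)ᶜ ≤ 1 / ((k : ℝ) + 1) := by
      refine ENNReal.toReal_le_of_le_ofReal (hε k).le (le_trans ?_ (hEσ k).le)
      calc σ (E k)ᶜ ≤ σ (S \ E k ∪ Sᶜ) := measure_mono fun t ht => by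
            by_cases h : t ∈ S
            · exact Or.inl ⟨h, ht⟩
            · exact Or.inr h
        _ ≤ σ (S \ E k) + σ Sᶜ := measure_union_le _ _
        _ = σ (S \ E k) := by rw [hS0, add_zero]
    have hcont := continuous_eval_fourier (Polynomial.X * q k)
    have hEm : MeasurableSet (E k)ᶜ := (hE k).isClosed.measurableSet.compl
    have hi := (integrable_const (μ := σ) (2 : ℝ)).indicator hEm
    calc ∫ t, ‖(1 : ℂ) - (Polynomial.X * q k).eval (fourier 1 t : ℂ)‖ ∂σ
        ≤ ∫ t, (1 / ((k : ℝ) + 1) + (E k)ᶜ.indicator (fun _ => (2 : ℝ)) t) ∂σ := by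
          refine integral_mono (Continuous.integrable_addCircle (by fun_prop))
            ((integrable_const _).add hi) fun t => ?_
          by_cases ht : t ∈ E k
          · have h1 : t ∉ (E k)ᶜ := fun h => h ht
            simp only [Set.indicator_of_notMem h1, add_zero]
            exact hqE k t ht
          · have h1 : t ∈ (E k)ᶜ := ht
            simp only [Set.indicator_of_mem h1]
            refine (norm_sub_le _ _).trans ?_
            rw [norm_one, hXq]
            linarith [hq1 k t, hε k]
      _ = (1 / ((k : ℝ) + 1)) * σ.real Set.univ + 2 * σ.real (E k)ᶜ := by
          rw [integral_add (integrable_const _) hi, integral_indicator hEm]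
          simp [mul_comm]
      _ ≤ (1 / ((k : ℝ) + 1)) * (σ.real Set.univ + 2) := by nlinarith
  · refine tendsto_integral_norm_of_absolutelyContinuous (m := haarAddCircle)
      (withDensity_absolutelyContinuous _ _)
      (fun k => (continuous_eval_fourier _).stronglyMeasurable) (B := 1)
      (fun k t => (hXq k t).trans_le (hq1 k t)) ?_
    refine squeeze_zero (fun k => integral_nonneg fun t => by positivity) (fun k => ?_) hlim
    simp only [hXq]
    exact hqm k

/-- The elementary measures of a completely non-unitary contraction are absolutely continuous. -/
theorem IsElementaryMeasure.absolutelyContinuous {T : H →L[ℂ] H} (hT : IsCNUContraction T)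
    {x : H} {μ : Measure (AddCircle (1 : ℝ))} [IsFiniteMeasure μ]
    (hμ : IsElementaryMeasure T x μ) : μ ≪ haarAddCircle := by
  obtain ⟨q, hq, hσ, hα⟩ := exists_seq_polynomial_separating μ
  have hdec := μ.haveLebesgueDecomposition_add haarAddCircle
  set σ := μ.singularPart haarAddCircle
  set α := haarAddCircle.withDensity (μ.rnDeriv haarAddCircle)
  have hadd : ∀ {E : Type} [NormedAddCommGroup E] [NormedSpace ℝ E]
      {f : AddCircle (1 : ℝ) → E}, Continuous f →
      ∫ t, f t ∂μ = ∫ t, f t ∂σ + ∫ t, f t ∂α := by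
    intro E _ _ f hf
    rw [hdec, integral_add_measure hf.integrable_addCircle hf.integrable_addCircle]
  set g : ℕ → AddCircle (1 : ℝ) → ℂ := fun k t => (Polynomial.X * q k).eval (fourier 1 t : ℂ)
    with hg
  have hgc : ∀ k, Continuous (g k) := fun k => continuous_eval_fourier _
  have hg1 : ∀ k t, ‖g k t‖ ≤ 1 := fun k t => by
    simp only [hg]
    rw [mul_comm, Polynomial.eval_mul_X, norm_mul, norm_fourier_apply, mul_one]
    exact hq k t
  have hg2 : ∀ k t, ‖1 - g k t‖ ≤ 2 := fun k t =>
    (norm_sub_le _ _).trans (by rw [norm_one]; linarith [hg1 k t])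
  -- `D k` measures how far `g k` is from the indicator of the singular part; it bounds every error
  -- below.
  set D : ℕ → ℝ := fun k => ∫ t, ‖1 - g k t‖ ∂σ + ∫ t, ‖g k t‖ ∂α with hD
  have hD0 : Tendsto D atTop (𝓝 0) := by
    rw [← add_zero (0 : ℝ)]
    exact hσ.add hα
  set G : ℕ → H →L[ℂ] H := fun k => Polynomial.aeval T (Polynomial.X * q k) with hG
  have hGn : ∀ k v, ‖G k v‖ ≤ ‖v‖ := fun k v =>
    (norm_aeval_apply_le hT.1 (hg1 k) v).trans_eq (one_mul _)
  have hcauchy : ∀ j k, ‖G j x - G k x‖ ^ 2 ≤ 2 * (D j + D k) := by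
    intro j k
    have hcj := hgc j
    have hck := hgc k
    have h1 := hμ.norm_aeval_sq_le hT.1 (Polynomial.X * q j - Polynomial.X * q k)
    rw [map_sub, sub_apply] at h1
    refine h1.trans ?_
    simp only [Polynomial.eval_sub]
    change ∫ t, ‖g j t - g k t‖ ^ 2 ∂μ ≤ _
    have h2 : ∀ t, ‖g j t - g k t‖ ^ 2 ≤ 2 * ‖g j t - g k t‖ := fun t => by
      have := (norm_sub_le (g j t) (g k t)).trans (add_le_add (hg1 j t) (hg1 k t))
      nlinarith [norm_nonneg (g j t - g k t)]
    rw [hadd (by fun_prop)]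
    have h3 : ∫ t, ‖g j t - g k t‖ ^ 2 ∂σ ≤ 2 * (∫ t, ‖1 - g j t‖ ∂σ + ∫ t, ‖1 - g k t‖ ∂σ) := by
      rw [← integral_add (Continuous.integrable_addCircle (by fun_prop))
        (Continuous.integrable_addCircle (by fun_prop)), ← integral_const_mul]
      refine integral_mono (Continuous.integrable_addCircle (by fun_prop))
        (Continuous.integrable_addCircle (by fun_prop)) fun t => (h2 t).trans ?_
      have := norm_sub_le (1 - g k t) (1 - g j t)
      rw [sub_sub_sub_cancel_left] at this
      linarith
    have h4 : ∫ t, ‖g j t - g k t‖ ^ 2 ∂α ≤ 2 * (∫ t, ‖g j t‖ ∂α + ∫ t, ‖g k t‖ ∂α) := by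
      rw [← integral_add (Continuous.integrable_addCircle (by fun_prop))
        (Continuous.integrable_addCircle (by fun_prop)), ← integral_const_mul]
      refine integral_mono (Continuous.integrable_addCircle (by fun_prop))
        (Continuous.integrable_addCircle (by fun_prop)) fun t => (h2 t).trans ?_
      have := norm_sub_le (g j t) (g k t)
      linarith
    simp only [hD]
    linarith
  -- `G k` is almost idempotent at `x`, because `g² - g = -(1 - g) g` has one small factor on each
  -- part of `μ`. Hence `y = lim G k x` satisfies `G k y → y`.
  have hidem : ∀ k, ‖G k (G k x) - G k x‖ ^ 2 ≤ 4 * D k := by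
    intro k
    have hck := hgc k
    have h1 := hμ.norm_aeval_sq_le hT.1
      ((Polynomial.X * q k) * (Polynomial.X * q k) - Polynomial.X * q k)
    rw [map_sub, map_mul, sub_apply, mul_apply_eq_comp] at h1
    refine h1.trans ?_
    simp only [Polynomial.eval_sub, Polynomial.eval_mul (p := Polynomial.X * q k)]
    change ∫ t, ‖g k t * g k t - g k t‖ ^ 2 ∂μ ≤ _
    have h2 : ∀ t, ‖g k t * g k t - g k t‖ ^ 2 = ‖1 - g k t‖ ^ 2 * ‖g k t‖ ^ 2 := fun t => by
      rw [← mul_pow, ← norm_mul, ← norm_neg]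
      congr 2
      ring
    rw [hadd (by fun_prop), hD, mul_add, ← integral_const_mul, ← integral_const_mul]
    refine add_le_add ?_ ?_
    · refine integral_mono (Continuous.integrable_addCircle (by fun_prop))
        (Continuous.integrable_addCircle (by fun_prop)) fun t => ?_
      simp only [h2]
      have h3 : ‖g k t‖ ^ 2 ≤ 1 := pow_le_one₀ (norm_nonneg _) (hg1 k t)
      have h4 := mul_le_mul_of_nonneg_left h3 (sq_nonneg ‖1 - g k t‖)
      nlinarith [hg2 k t, norm_nonneg (1 - g k t)]
    · refine integral_mono (Continuous.integrable_addCircle (by fun_prop))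
        (Continuous.integrable_addCircle (by fun_prop)) fun t => ?_
      simp only [h2]
      have h3 : ‖1 - g k t‖ ^ 2 ≤ 2 ^ 2 := pow_le_pow_left₀ (norm_nonneg _) (hg2 k t) 2
      have h4 := mul_le_mul_of_nonneg_right h3 (sq_nonneg ‖g k t‖)
      nlinarith [hg1 k t, norm_nonneg (g k t)]
  obtain ⟨y, hy⟩ : ∃ y, Tendsto (fun k => G k x) atTop (𝓝 y) := by
    refine cauchySeq_tendsto_of_complete (Metric.cauchySeq_iff.2 fun ε hε => ?_)
    obtain ⟨N, hN⟩ := eventually_atTop.1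
      (hD0.eventually (gt_mem_nhds (show (0 : ℝ) < ε ^ 2 / 4 by positivity)))
    refine ⟨N, fun j hj k hk => ?_⟩
    rw [dist_eq_norm]
    refine lt_of_pow_lt_pow_left₀ 2 hε.le ?_
    linarith [hcauchy j k, hN j hj, hN k hk]
  have hyG : Tendsto (fun k => G k y) atTop (𝓝 y) := by
    rw [tendsto_iff_norm_sub_tendsto_zero] at hy ⊢
    refine squeeze_zero (g := fun k => 2 * ‖G k x - y‖ + Real.sqrt (4 * D k))
      (fun k => norm_nonneg _) (fun k => ?_)
      ?_
    swap
    · have h1 := (Real.continuous_sqrt.tendsto _).comp (hD0.const_mul 4)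
      have h2 := (hy.const_mul 2).add h1
      rwa [mul_zero, mul_zero, Real.sqrt_zero, add_zero] at h2
    have h1 : G k y - y = -(G k (G k x - y)) + (G k (G k x) - G k x) + (G k x - y) := by
      rw [map_sub]; abel
    have h2 := norm_add₃_le (a := -(G k (G k x - y))) (b := G k (G k x) - G k x) (c := G k x - y)
    rw [norm_neg] at h2
    rw [h1]
    linarith [hGn k (G k x - y), Real.le_sqrt_of_sq_le (hidem k)]
  -- Since `G k = T qₖ(T)`, `y` is fixed in the limit in the sense of
  -- `IsCNUContraction.eq_zero_of_tendsto`. The factor `X` in the peak polynomials serves this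
  -- purpose.
  have hy0 : y = 0 := by
    refine hT.eq_zero_of_tendsto (S := fun k => Polynomial.aeval T (q k)) (fun k v => ?_)
      (fun k v => aeval_apply_self_comm T (q k) v) (fun j k v => aeval_apply_comm T _ _ v) ?_
    · exact (norm_aeval_apply_le hT.1 (hq k) v).trans_eq (one_mul _)
    · simpa only [hG, aeval_X_mul_apply] using hyG
  have hσ0 : σ.real Set.univ = 0 := by
    have h1 : Tendsto (fun k => inner ℂ x (G k x)) atTop (𝓝 0) := by
      have := tendsto_const_nhds (x := x) |>.inner (𝕜 := ℂ) hy
      rwa [hy0, inner_zero_right] at this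
    have h2 : Tendsto (fun k => inner ℂ x (G k x)) atTop (𝓝 (σ.real Set.univ : ℂ)) := by
      rw [tendsto_iff_norm_sub_tendsto_zero]
      refine squeeze_zero (fun k => norm_nonneg _) (fun k => ?_) hD0
      have hck := hgc k
      have h3 : inner ℂ x (G k x) - (σ.real Set.univ : ℂ)
          = -∫ t, (1 - g k t) ∂σ + ∫ t, g k t ∂α := by
        rw [hG, hμ.inner_aeval]
        change ∫ t, g k t ∂μ - _ = _
        rw [hadd hck, integral_sub (integrable_const _) hck.integrable_addCircle]
        simp
        ring
      rw [h3]
      refine (norm_add_le _ _).trans ?_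
      rw [norm_neg]
      exact add_le_add (norm_integral_le_integral_norm _) (norm_integral_le_integral_norm _)
    exact_mod_cast tendsto_nhds_unique h2 h1
  have hσ00 : σ = 0 := by
    rw [← Measure.measure_univ_eq_zero]
    exact (measureReal_eq_zero_iff (measure_ne_top _ _)).1 hσ0
  rw [hdec, hσ00, zero_add]
  exact withDensity_absolutelyContinuous _ _

end AbsoluteContinuity

/-! ### Taylor coefficients of bounded analytic functions -/

section TaylorCoefficients

theorem MemHInfty.hasSum_taylorCoeffZero {u : ℂ → ℂ} (hu : MemHInfty u) {z : ℂ} (hz : ‖z‖ < 1) :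
    HasSum (fun n => taylorCoeffZero u n * z ^ n) (u z) := by
  have h := Complex.hasSum_taylorSeries_on_ball hu.1 (z := z) (by simpa using hz)
  refine h.congr_fun fun n => ?_
  simp only [taylorCoeffZero, sub_zero, smul_eq_mul]
  ring

theorem MemHInfty.summable_norm_taylorCoeffZero_mul_pow {u : ℂ → ℂ} (hu : MemHInfty u) {r : ℝ}
    (hr : r ∈ Set.Ico (0 : ℝ) 1) : Summable fun n => ‖taylorCoeffZero u n * (r : ℂ) ^ n‖ :=
  (hu.hasSum_taylorCoeffZero (by rw [Complex.norm_real, Real.norm_of_nonneg hr.1]; exact hr.2)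
    ).summable.norm

theorem norm_ofReal_mul_fourier {r : ℝ} (hr : r ∈ Set.Ico (0 : ℝ) 1) (t : AddCircle (1 : ℝ)) :
    ‖(r : ℂ) * fourier 1 t‖ < 1 := by
  rw [norm_mul, norm_fourier_apply, mul_one, Complex.norm_real, Real.norm_of_nonneg hr.1]
  exact hr.2

theorem MemHInfty.tsum_taylorCoeffZero_mul_fourier {u : ℂ → ℂ} (hu : MemHInfty u) {r : ℝ}
    (hr : r ∈ Set.Ico (0 : ℝ) 1) (t : AddCircle (1 : ℝ)) :
    ∑' n : ℕ, taylorCoeffZero u n * (r : ℂ) ^ n * fourier (n : ℤ) t = u (r * fourier 1 t) := by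
  rw [← (hu.hasSum_taylorCoeffZero (norm_ofReal_mul_fourier hr t)).tsum_eq]
  refine tsum_congr fun n => ?_
  rw [fourier_natCast_eq_pow, mul_pow, mul_assoc]

theorem MemHInfty.exists_norm_tsum_le {u : ℂ → ℂ} (hu : MemHInfty u) :
    ∃ C : ℝ, ∀ r ∈ Set.Ico (0 : ℝ) 1, ∀ t : AddCircle (1 : ℝ),
      ‖∑' n : ℕ, taylorCoeffZero u n * (r : ℂ) ^ n * fourier (n : ℤ) t‖ ≤ C := by
  obtain ⟨C, hC⟩ := hu.2
  refine ⟨C, fun r hr t => ?_⟩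
  rw [hu.tsum_taylorCoeffZero_mul_fourier hr]
  exact hC _ (by simpa using norm_ofReal_mul_fourier hr t)

theorem Ico_zero_one_mem_nhdsLT_one : Set.Ico (0 : ℝ) 1 ∈ 𝓝[<] (1 : ℝ) :=
  Ico_mem_nhdsLT one_pos

/-- The Taylor coefficients of a bounded analytic function are square summable. -/
theorem MemHInfty.summable_norm_sq_taylorCoeffZero {u : ℂ → ℂ} (hu : MemHInfty u) :
    Summable fun n => ‖taylorCoeffZero u n‖ ^ 2 := by
  obtain ⟨C, hC⟩ := hu.exists_norm_tsum_le
  refine summable_of_sum_le (c := C ^ 2) (fun n => by positivity) fun s => ?_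
  -- For a fixed finite set of indices one may let `r → 1` in the Parseval bound, which is uniform
  -- in `r`.
  have h1 : Tendsto (fun r : ℝ => ∑ n ∈ s, ‖taylorCoeffZero u n * (r : ℂ) ^ n‖ ^ 2) (𝓝[<] 1)
      (𝓝 (∑ n ∈ s, ‖taylorCoeffZero u n‖ ^ 2)) := by
    have h2 : Continuous fun r : ℝ => ∑ n ∈ s, ‖taylorCoeffZero u n * (r : ℂ) ^ n‖ ^ 2 := by
      fun_prop
    simpa using (h2.tendsto 1).mono_left nhdsWithin_le_nhds
  refine le_of_tendsto h1 ?_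
  filter_upwards [Ico_zero_one_mem_nhdsLT_one] with r hr
  have h3 := hasSum_norm_sq_integral_norm_sq_tsum_fourier
    (hu.summable_norm_taylorCoeffZero_mul_pow hr)
  refine (sum_le_hasSum s (fun _ _ => by positivity) h3).trans ?_
  calc _ ≤ ∫ _, C ^ 2 ∂(haarAddCircle (T := 1)) := by
        refine integral_mono_of_nonneg (Eventually.of_forall fun t => by positivity)
          (integrable_const _) (Eventually.of_forall fun t => ?_)
        exact pow_le_pow_left₀ (norm_nonneg _) (hC r hr t) 2
    _ = C ^ 2 := by simp

theorem MemHInfty.contDiffAt_zero {u : ℂ → ℂ} (hu : MemHInfty u) (n : WithTop ℕ∞) :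
    ContDiffAt ℂ n u 0 :=
  (hu.1.analyticAt (Metric.ball_mem_nhds 0 one_pos)).contDiffAt

theorem MemHInfty.const (c : ℂ) : MemHInfty fun _ => c :=
  ⟨differentiableOn_const c, ‖c‖, fun _ _ => le_rfl⟩

theorem MemHInfty.add {u v : ℂ → ℂ} (hu : MemHInfty u) (hv : MemHInfty v) :
    MemHInfty (u + v) := by
  obtain ⟨hu1, C, hC⟩ := hu
  obtain ⟨hv1, D, hD⟩ := hv
  exact ⟨hu1.add hv1, C + D, fun z hz => norm_add_le_of_le (hC z hz) (hD z hz)⟩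

theorem MemHInfty.mul {u v : ℂ → ℂ} (hu : MemHInfty u) (hv : MemHInfty v) :
    MemHInfty (u * v) := by
  obtain ⟨hu1, C, hC⟩ := hu
  obtain ⟨hv1, D, hD⟩ := hv
  exact ⟨hu1.mul hv1, C * D, fun z hz => norm_mul_le_of_le (hC z hz) (hD z hz)⟩

theorem taylorCoeffZero_const (c : ℂ) (n : ℕ) :
    taylorCoeffZero (fun _ => c) n = if n = 0 then c else 0 := by
  rw [taylorCoeffZero, iteratedDeriv_const]
  split_ifs with h <;> simp [h]

theorem MemHInfty.taylorCoeffZero_add {u v : ℂ → ℂ} (hu : MemHInfty u) (hv : MemHInfty v) (n : ℕ) :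
    taylorCoeffZero (u + v) n = taylorCoeffZero u n + taylorCoeffZero v n := by
  rw [taylorCoeffZero, iteratedDeriv_add (hu.contDiffAt_zero n) (hv.contDiffAt_zero n), add_div]
  rfl

theorem MemHInfty.taylorCoeffZero_mul {u v : ℂ → ℂ} (hu : MemHInfty u) (hv : MemHInfty v) (n : ℕ) :
    taylorCoeffZero (u * v) n
      = ∑ k ∈ Finset.range (n + 1), taylorCoeffZero u k * taylorCoeffZero v (n - k) := by
  rw [taylorCoeffZero, iteratedDeriv_mul (hu.contDiffAt_zero n) (hv.contDiffAt_zero n),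
    Finset.sum_div]
  refine Finset.sum_congr rfl fun k hk => ?_
  have hkn : k ≤ n := Nat.lt_succ_iff.1 (Finset.mem_range.1 hk)
  have h1 : ((n.choose k : ℕ) : ℂ) * (k.factorial : ℂ) * ((n - k).factorial : ℂ)
      = (n.factorial : ℂ) := by exact_mod_cast Nat.choose_mul_factorial_mul_factorial hkn
  have h2 : (k.factorial : ℂ) ≠ 0 := by exact_mod_cast k.factorial_ne_zero
  have h3 : ((n - k).factorial : ℂ) ≠ 0 := by exact_mod_cast (n - k).factorial_ne_zero
  have h4 : (n.factorial : ℂ) ≠ 0 := by exact_mod_cast n.factorial_ne_zero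
  rw [taylorCoeffZero, taylorCoeffZero]
  field_simp
  rw [← h1]
  ring

end TaylorCoefficients

/-! ### Existence and multiplicativity of the functional calculus -/

section Calculus

variable {H : Type*} [NormedAddCommGroup H] [InnerProductSpace ℂ H]

theorem dilatedCalculus_const (T : H →L[ℂ] H) (c : ℂ) (r : ℝ) :
    dilatedCalculus T (fun _ => c) r = algebraMap ℂ (H →L[ℂ] H) c := by
  rw [dilatedCalculus, tsum_eq_single 0 fun n hn => by simp [taylorCoeffZero_const, hn]]
  simp [taylorCoeffZero_const, Algebra.algebraMap_eq_smul_one]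

theorem summable_dilatedCalculus {T : H →L[ℂ] H} (hT : ‖T‖ ≤ 1) {u : ℂ → ℂ} (hu : MemHInfty u)
    {r : ℝ} (hr : r ∈ Set.Ico (0 : ℝ) 1) :
    Summable fun n => ‖(taylorCoeffZero u n * (r : ℂ) ^ n) • T ^ n‖ :=
  summable_norm_smul_pow hT (hu.summable_norm_taylorCoeffZero_mul_pow hr)

theorem IsHInftyCalculusValue.const (T : H →L[ℂ] H) (c : ℂ) :
    IsHInftyCalculusValue T (fun _ => c) (algebraMap ℂ (H →L[ℂ] H) c) := by
  intro x
  simp only [dilatedCalculus_const]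
  exact tendsto_const_nhds

variable [CompleteSpace H]

/-- **Von Neumann's inequality** for the dilated functional calculus. -/
theorem exists_norm_dilatedCalculus_apply_le {T : H →L[ℂ] H} (hT : ‖T‖ ≤ 1) {u : ℂ → ℂ}
    (hu : MemHInfty u) :
    ∃ C : ℝ, ∀ r ∈ Set.Ico (0 : ℝ) 1, ∀ x, ‖dilatedCalculus T u r x‖ ≤ C * ‖x‖ := by
  obtain ⟨C, hC⟩ := hu.exists_norm_tsum_le
  exact ⟨C, fun r hr x => norm_tsum_smul_pow_apply_le hT
    (hu.summable_norm_taylorCoeffZero_mul_pow hr) (hC r hr) x⟩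

theorem dilatedCalculus_add {T : H →L[ℂ] H} (hT : ‖T‖ ≤ 1) {u v : ℂ → ℂ} (hu : MemHInfty u)
    (hv : MemHInfty v) {r : ℝ} (hr : r ∈ Set.Ico (0 : ℝ) 1) :
    dilatedCalculus T (u + v) r = dilatedCalculus T u r + dilatedCalculus T v r := by
  rw [dilatedCalculus, dilatedCalculus, dilatedCalculus,
    ← (summable_dilatedCalculus hT hu hr).of_norm.tsum_add
      (summable_dilatedCalculus hT hv hr).of_norm]
  refine tsum_congr fun n => ?_
  rw [hu.taylorCoeffZero_add hv, add_mul, add_smul]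

theorem dilatedCalculus_mul {T : H →L[ℂ] H} (hT : ‖T‖ ≤ 1) {u v : ℂ → ℂ} (hu : MemHInfty u)
    (hv : MemHInfty v) {r : ℝ} (hr : r ∈ Set.Ico (0 : ℝ) 1) :
    dilatedCalculus T (u * v) r = dilatedCalculus T u r * dilatedCalculus T v r := by
  rw [dilatedCalculus, dilatedCalculus, dilatedCalculus,
    tsum_mul_tsum_eq_tsum_sum_range_of_summable_norm (summable_dilatedCalculus hT hu hr)
      (summable_dilatedCalculus hT hv hr)]
  refine tsum_congr fun n => ?_
  rw [hu.taylorCoeffZero_mul hv, Finset.sum_mul, Finset.sum_smul]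
  refine Finset.sum_congr rfl fun k hk => ?_
  obtain ⟨j, rfl⟩ := Nat.exists_eq_add_of_le (Nat.lt_succ_iff.1 (Finset.mem_range.1 hk))
  rw [Nat.add_sub_cancel_left, smul_mul_smul_comm, ← pow_add]
  congr 1
  ring

/-- For a completely non-unitary contraction `T` and `u ∈ H^∞`, the vectors `u_r(T) x` converge. -/
theorem IsCNUContraction.exists_tendsto_dilatedCalculus_apply {T : H →L[ℂ] H}
    (hT : IsCNUContraction T) {u : ℂ → ℂ} (hu : MemHInfty u) (x : H) :
    ∃ y, Tendsto (fun r : ℝ => dilatedCalculus T u r x) (𝓝[<] (1 : ℝ)) (𝓝 y) := by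
  obtain ⟨μ, hμfin, hμ⟩ := exists_measure_integral_fourier_eq_inner hT.1 x
  have hμ : IsElementaryMeasure T x μ := hμ
  have hac := hμ.absolutelyContinuous hT
  obtain ⟨C, hC⟩ := hu.exists_norm_tsum_le
  set a := taylorCoeffZero u with ha
  set val : Set.Ico (0 : ℝ) 1 → ℝ := Subtype.val with hval
  have hrange : Set.range val ∈ 𝓝[<] (1 : ℝ) := by
    rw [hval, Subtype.range_val]; exact Ico_zero_one_mem_nhdsLT_one
  -- Working on the subtype makes the bounds hold at every index, as the transfer lemma demands,
  -- rather than eventually.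
  set L : Filter (Set.Ico (0 : ℝ) 1) := comap val (𝓝[<] (1 : ℝ)) with hL
  have hLne : L.NeBot := comap_neBot_iff_compl_range.2 fun h => by
    have := inter_mem hrange h
    rw [Set.inter_compl_self] at this
    exact (inferInstance : (𝓝[<] (1 : ℝ)).NeBot).ne (empty_mem_iff_bot.1 this)
  have hL1 : Tendsto val L (𝓝 1) := tendsto_comap.mono_right nhdsWithin_le_nhds
  have hs : ∀ r : Set.Ico (0 : ℝ) 1, Summable fun n => ‖a n * (val r : ℂ) ^ n‖ := fun r =>
    hu.summable_norm_taylorCoeffZero_mul_pow r.2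
  set b : Set.Ico (0 : ℝ) 1 × Set.Ico (0 : ℝ) 1 → ℕ → ℂ := fun p n =>
    a n * (val p.1 : ℂ) ^ n - a n * (val p.2 : ℂ) ^ n with hb
  have hbs : ∀ p, Summable fun n => ‖b p n‖ := fun p =>
    Summable.of_nonneg_of_le (fun _ => norm_nonneg _) (fun n => norm_sub_le _ _)
      ((hs p.1).add (hs p.2))
  set φ : Set.Ico (0 : ℝ) 1 × Set.Ico (0 : ℝ) 1 → AddCircle (1 : ℝ) → ℂ := fun p t =>
    ∑' n : ℕ, b p n * fourier (n : ℤ) t with hφ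
  have hφc : ∀ p, Continuous (φ p) := fun p => continuous_tsum_fourier (hbs p)
  have hφB : ∀ p t, ‖φ p t‖ ≤ 2 * C := by
    intro p t
    have hst : ∀ r : Set.Ico (0 : ℝ) 1,
        Summable fun n : ℕ => a n * (val r : ℂ) ^ n * fourier (n : ℤ) t := fun r =>
      Summable.of_norm ((hs r).congr fun n => by
        rw [norm_mul _ (fourier (n : ℤ) t), norm_fourier_apply, mul_one])
    simp only [hφ, hb, sub_mul]
    rw [(hst p.1).tsum_sub (hst p.2)]
    refine (norm_sub_le _ _).trans ?_
    linarith [hC _ p.1.2 t, hC _ p.2.2 t]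
  have hφ2 : Tendsto (fun p => ∫ t, ‖φ p t‖ ^ 2 ∂haarAddCircle) (L ×ˢ L) (𝓝 0) := by
    have h1 : ∀ p, ∫ t, ‖φ p t‖ ^ 2 ∂haarAddCircle = ∑' n, ‖b p n‖ ^ 2 := fun p =>
      (hasSum_norm_sq_integral_norm_sq_tsum_fourier (hbs p)).tsum_eq.symm
    simp only [h1]
    suffices h0 : Tendsto (fun p => ∑' n, ‖b p n‖ ^ 2) (L ×ˢ L) (𝓝 (∑' _ : ℕ, (0 : ℝ))) by
      rwa [tsum_zero] at h0
    refine tendsto_tsum_of_dominated_convergence hu.summable_norm_sq_taylorCoeffZero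
      (fun n => ?_) (Eventually.of_forall fun p n => ?_)
    · have hc : Continuous fun q : ℝ × ℝ => ‖a n * (q.1 : ℂ) ^ n - a n * (q.2 : ℂ) ^ n‖ ^ 2 := by
        fun_prop
      have h2 := (hc.tendsto (1, 1)).comp
        ((hL1.comp tendsto_fst).prodMk_nhds (hL1.comp tendsto_snd) :
          Tendsto (fun p => (val p.1, val p.2)) (L ×ˢ L) (𝓝 (1, 1)))
      simp only [one_pow, sub_self, norm_zero, Complex.ofReal_one, ne_eq, OfNat.ofNat_ne_zero,
        not_false_eq_true, zero_pow] at h2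
      exact h2
    · have h3 : |val p.1 ^ n - val p.2 ^ n| ≤ 1 := by
        have h4 : ∀ r : Set.Ico (0 : ℝ) 1, 0 ≤ val r ^ n ∧ val r ^ n ≤ 1 := fun r =>
          ⟨pow_nonneg r.2.1 n, pow_le_one₀ r.2.1 r.2.2.le⟩
        rw [abs_le]
        constructor <;> linarith [(h4 p.1).1, (h4 p.1).2, (h4 p.2).1, (h4 p.2).2]
      have h5 : ‖b p n‖ = ‖a n‖ * |val p.1 ^ n - val p.2 ^ n| := by
        simp only [hb]
        rw [← mul_sub, norm_mul, ← Real.norm_eq_abs, ← Complex.norm_real]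
        push_cast
        rfl
      rw [Real.norm_of_nonneg (by positivity), h5]
      exact pow_le_pow_left₀ (by positivity) (mul_le_of_le_one_right (norm_nonneg _) h3) 2
  have hφ1 : Tendsto (fun p => ∫ t, ‖φ p t‖ ∂μ) (L ×ˢ L) (𝓝 0) :=
    tendsto_integral_norm_of_absolutelyContinuous hac
      (fun p => (hφc p).stronglyMeasurable) hφB hφ2
  set f : Set.Ico (0 : ℝ) 1 → H := fun r => dilatedCalculus T u (val r) x with hf
  -- The uniform bound `|φ| ≤ 2C` trades the mean square for the mean, which is what absolute
  -- continuity controls.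
  have hfle : ∀ p : Set.Ico (0 : ℝ) 1 × Set.Ico (0 : ℝ) 1,
      ‖f p.1 - f p.2‖ ^ 2 ≤ 2 * C * ∫ t, ‖φ p t‖ ∂μ := by
    intro p
    have h1 : (∑' n, b p n • T ^ n) x = f p.1 - f p.2 := by
      simp only [hf, hb, sub_smul]
      rw [((summable_dilatedCalculus hT.1 hu p.1.2).of_norm).tsum_sub
        (summable_dilatedCalculus hT.1 hu p.2.2).of_norm]
      rfl
    rw [← h1]
    refine (hμ.norm_tsum_sq_le hT.1 (hbs p)).trans ?_
    have hc := hφc p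
    rw [← integral_const_mul]
    refine integral_mono (Continuous.integrable_addCircle (hc.norm.pow 2))
      (Continuous.integrable_addCircle (continuous_const.mul hc.norm)) fun t => ?_
    have h2 := mul_le_mul_of_nonneg_right (hφB p t) (norm_nonneg (φ p t))
    simp only
    rw [sq]
    exact h2
  have hcauchy : Cauchy (L.map f) := by
    rw [cauchy_map_iff]
    refine ⟨hLne, ?_⟩
    rw [tendsto_uniformity_iff_dist_tendsto_zero]
    have h1 := (Real.continuous_sqrt.tendsto _).comp (hφ1.const_mul (2 * C))
    rw [mul_zero, Real.sqrt_zero] at h1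
    refine squeeze_zero (fun p => dist_nonneg) (fun p => ?_) h1
    rw [dist_eq_norm]
    exact Real.le_sqrt_of_sq_le (hfle p)
  obtain ⟨y, hy⟩ := CompleteSpace.complete hcauchy
  exact ⟨y, (tendsto_comap'_iff hrange).1 hy⟩

/-- The Sz.-Nagy–Foias functional calculus exists for completely non-unitary contractions. -/
theorem IsCNUContraction.isHInftyCalculusValue {T : H →L[ℂ] H} (hT : IsCNUContraction T)
    {u : ℂ → ℂ} (hu : MemHInfty u) : IsHInftyCalculusValue T u (hInftyCalculus T u) := by
  choose f hf using fun x => hT.exists_tendsto_dilatedCalculus_apply hu x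
  -- By Banach–Steinhaus the pointwise limit is a bounded operator.
  have hS : IsHInftyCalculusValue T u
      (continuousLinearMapOfTendsto _ (tendsto_pi_nhds.2 hf)) := hf
  rwa [hInftyCalculus_eq hS]

theorem IsHInftyCalculusValue.add {T : H →L[ℂ] H} (hT : ‖T‖ ≤ 1) {u v : ℂ → ℂ}
    (hu : MemHInfty u) (hv : MemHInfty v) {A B : H →L[ℂ] H} (hA : IsHInftyCalculusValue T u A)
    (hB : IsHInftyCalculusValue T v B) : IsHInftyCalculusValue T (u + v) (A + B) := by
  intro x
  refine ((hA x).add (hB x)).congr' ?_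
  filter_upwards [Ico_zero_one_mem_nhdsLT_one] with r hr
  rw [dilatedCalculus_add hT hu hv hr]
  rfl

/-- Strong limits multiply because the operators `u_r(T)` are uniformly bounded: `u_r(T) v_r(T) x =
u_r(T) (v_r(T) x - B x) + u_r(T) B x`. -/
theorem IsHInftyCalculusValue.mul {T : H →L[ℂ] H} (hT : ‖T‖ ≤ 1) {u v : ℂ → ℂ}
    (hu : MemHInfty u) (hv : MemHInfty v) {A B : H →L[ℂ] H} (hA : IsHInftyCalculusValue T u A)
    (hB : IsHInftyCalculusValue T v B) : IsHInftyCalculusValue T (u * v) (A * B) := by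
  intro x
  obtain ⟨C, hC⟩ := exists_norm_dilatedCalculus_apply_le hT hu
  have h1 : Tendsto (fun r => dilatedCalculus T u r (dilatedCalculus T v r x - B x)) (𝓝[<] 1)
      (𝓝 0) := by
    refine squeeze_zero_norm' (a := fun r => C * ‖dilatedCalculus T v r x - B x‖) ?_ ?_
    · filter_upwards [Ico_zero_one_mem_nhdsLT_one] with r hr
      exact hC r hr _
    · simpa using (tendsto_iff_norm_sub_tendsto_zero.1 (hB x)).const_mul C
  have h2 := h1.add (hA (B x))
  rw [zero_add] at h2
  refine h2.congr' ?_
  filter_upwards [Ico_zero_one_mem_nhdsLT_one] with r hr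
  rw [dilatedCalculus_mul hT hu hv hr, map_sub, sub_add_cancel]
  rfl

/-- The functional calculus is compatible with polynomials: `(p ∘ θ)(T) = p(θ(T))`. -/
theorem IsHInftyCalculusValue.polynomial_comp {T : H →L[ℂ] H} (hT : ‖T‖ ≤ 1) {θ : ℂ → ℂ}
    (hθ : MemHInfty θ) {A : H →L[ℂ] H} (hA : IsHInftyCalculusValue T θ A) (p : Polynomial ℂ) :
    MemHInfty (fun z => p.eval (θ z)) ∧
      IsHInftyCalculusValue T (fun z => p.eval (θ z)) (Polynomial.aeval A p) := by
  induction p using Polynomial.induction_on with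
  | C c =>
    simp only [Polynomial.eval_C, Polynomial.aeval_C]
    exact ⟨MemHInfty.const c, IsHInftyCalculusValue.const T c⟩
  | add p q hp hq =>
    simp only [Polynomial.eval_add, map_add]
    exact ⟨hp.1.add hq.1, IsHInftyCalculusValue.add hT hp.1 hq.1 hp.2 hq.2⟩
  | monomial n c ih =>
    simp only [pow_succ, ← mul_assoc, Polynomial.eval_mul_X, map_mul _ _ Polynomial.X,
      Polynomial.aeval_X]
    exact ⟨ih.1.mul hθ, IsHInftyCalculusValue.mul hT ih.1 hθ ih.2 hA⟩

end Calculus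

/-! ### Polynomials in `θ(T)` and linear independence -/

section Transcendental

theorem NonconstantOnDisk.nonzeroOnDisk_polynomial_comp {θ : ℂ → ℂ} (hθ : MemHInfty θ)
    (hθ' : NonconstantOnDisk θ) {p : Polynomial ℂ} (hp : p ≠ 0) :
    NonzeroOnDisk fun z => p.eval (θ z) := by
  by_contra hzero
  have hroot : Set.MapsTo θ (Metric.ball (0 : ℂ) 1) (p.rootSet ℂ) := by
    intro z hz
    rw [Polynomial.mem_rootSet]
    refine ⟨hp, ?_⟩
    rw [Polynomial.coe_aeval_eq_eval]
    by_contra hne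
    exact hzero ⟨z, hz, hne⟩
  refine hθ' ⟨θ 0, fun z hz => ?_⟩
  exact (convex_ball (0 : ℂ) 1).isPreconnected.constant_of_mapsTo (p.rootSet_finite ℂ).isDiscrete
    hθ.1.continuousOn hroot hz
    (Metric.mem_ball_self one_pos)

variable {H : Type*} [NormedAddCommGroup H] [InnerProductSpace ℂ H]

theorem linearIndependent_pow_apply_of_aeval_ne_zero {A : H →L[ℂ] H} {h : H}
    (hA : ∀ p : Polynomial ℂ, p ≠ 0 → Polynomial.aeval A p h ≠ 0) :
    LinearIndependent ℂ fun n : ℕ => (A ^ n) h := by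
  rw [linearIndependent_iff']
  intro s g hg i hi
  set p : Polynomial ℂ := ∑ j ∈ s, Polynomial.monomial j (g j) with hp
  have hp0 : p = 0 := by
    by_contra hne
    refine hA p hne ?_
    rw [hp, map_sum, sum_apply, ← hg]
    refine Finset.sum_congr rfl fun j _ => ?_
    rw [Polynomial.aeval_monomial, mul_apply_eq_comp, Algebra.algebraMap_eq_smul_one]
    simp
  have h1 := congrArg (fun q => Polynomial.coeff q i) hp0
  simpa [hp, Polynomial.finsetSum_coeff, Polynomial.coeff_monomial, hi] using h1

/-- The powers of `θ(T)` applied to a nonzero vector are linearly independent. -/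
theorem IsTranscendentalOperator.linearIndependent_pow_apply [CompleteSpace H] {T : H →L[ℂ] H}
    (hT : IsTranscendentalOperator T) {h : H} (hh : h ≠ 0) {θ : ℂ → ℂ} (hθ : MemHInfty θ)
    (hθ' : NonconstantOnDisk θ) :
    LinearIndependent ℂ fun n : ℕ => (hInftyCalculus T θ ^ n) h := by
  refine linearIndependent_pow_apply_of_aeval_ne_zero fun p hp h0 => hT.2 h hh ?_
  obtain ⟨hmem, hval⟩ := (hT.1.isHInftyCalculusValue hθ).polynomial_comp hT.1.1 hθ p
  exact ⟨_, hmem, hθ'.nonzeroOnDisk_polynomial_comp hθ hp, by rwa [hInftyCalculus_eq hval]⟩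

end Transcendental

theorem corollary6 {H : Type*} [NormedAddCommGroup H] [InnerProductSpace ℂ H] [CompleteSpace H]
    [TopologicalSpace.SeparableSpace H] (hH : ¬ FiniteDimensional ℂ H)
    (T : H →L[ℂ] H) (hT : IsTranscendentalOperator T)
    (h : H) (hh : h ≠ 0)
    (θ : ℂ → ℂ) (hθ : MemHInfty θ) (hθ' : NonconstantOnDisk θ) :
    Set.InjOn (fun n : ℕ => (hInftyCalculus T θ ^ n) h) {n : ℕ | 1 ≤ n} ∧
      LinearIndepOn ℂ id {x : H | ∃ n : ℕ, 1 ≤ n ∧ x = (hInftyCalculus T θ ^ n) h} := by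
  have hli := hT.linearIndependent_pow_apply hh hθ hθ'
  -- Independence of the family indexed by all `n ≥ 0` yields distinctness through injectivity, and
  -- independence of the smaller set by restriction.
  refine ⟨hli.injective.injOn, hli.linearIndepOn_id.mono ?_⟩
  rintro x ⟨n, -, rfl⟩
  exact ⟨n, rfl⟩
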